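/- All graphs are finite and simple. Let $2\mathcal C_{\ge 3}$ be the family of all vertex-disjoint unions of two cycles (each of length at least $3$). A graph $G$ is $2\mathcal C_{\ge 3}$-saturated if $G$ contains no member of $2\mathcal C_{\ge 3}$ as a subgraph, but for every pair of distinct non-adjacent vertices $u,v$ the graph $G+uv$ does. A subdivision of a graph $H$ is a graph obtained from $H$ by replacing its edges with internally disjoint paths of length at least $1$. For a graph $G$, let $M_0(G)$ be the graph obtained from $G$ by iteratively deleting vertices of degree one until none is left, and let the reduced core $M(G)$ be the graph with the minimum number of edges such that $M_0(G)$ is a subdivision of $M(G)$. Let $S_{p,3}=K_3\vee\overline{K_{p-3}}$ be the join of a triangle and an empty graph on $p-3$ vertices. **Theorem.** Let $G$ be a $2\mathcal C_{\ge 3}$-saturated graph with $n\ge 7$ vertices and $m\ge 2n-1$ edges. Then $M(G)$ is, up to isomorphism, uniquely determined, and $M(G)\cong S_{n_0,3}$ with $n_0=|V(M(G))|$, where $n_0\in[7,n]$, except that $n_0=6$ if $(n,m)=(7,13)$. In particular, $m-n$ is even. -/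

import Mathlib

namespace DisjointCycles

open SimpleGraph

/-- For a family `H i` of graphs: `G` contains no copy of a member of the family (as a subgraph,
not necessarily induced), but adding any missing edge creates a copy of some member. -/
def IsSaturated {ι : Type*} {X : ι → Type*} (H : (i : ι) → SimpleGraph (X i))
    {V : Type*} (G : SimpleGraph V) : Prop :=
  (∀ i, ¬ (H i).IsContained G) ∧
    ∀ u v : V, u ≠ v → ¬ G.Adj u v → ∃ i, (H i).IsContained (G ⊔ SimpleGraph.edge u v)

/-- The index set of the family of vertex-disjoint unions of two cycles: the pairs of lengths. -/
abbrev CyclePair : Type := {p : ℕ × ℕ // 3 ≤ p.1 ∧ 3 ≤ p.2}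

/-- The family of vertex-disjoint unions of two cycles, each of length at least three. -/
def twoCycles (p : CyclePair) : SimpleGraph (Fin p.1.1 ⊕ Fin p.1.2) :=
  cycleGraph p.1.1 ⊕g cycleGraph p.1.2

/-- The graph on `n` vertices in which `t` vertices (those with value less than `t`) are joined to
all other vertices, and the remaining vertices are pairwise non-adjacent: `K_t ∨ (n - t) K_1`. -/
def splitGraph (n t : ℕ) : SimpleGraph (Fin n) where
  Adj i j := i ≠ j ∧ ((i : ℕ) < t ∨ (j : ℕ) < t)
  symm := ⟨fun _ _ h => ⟨h.1.symm, h.2.symm⟩⟩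
  loopless := ⟨fun _ h => h.1 rfl⟩

/-- `H` is (isomorphic to) a subdivision of `G`: the vertices of `G` are embedded in `H` by `f`, and
the edges of `G` are replaced by internally disjoint paths of `H` that together make up `H`. -/
def IsSubdivision {V W : Type*} (H : SimpleGraph V) (G : SimpleGraph W) : Prop :=
  ∃ (f : W → V) (P : ∀ a b : W, G.Adj a b → H.Walk (f a) (f b)),
    Function.Injective f ∧
    (∀ a b (h : G.Adj a b), (P a b h).IsPath) ∧
    -- the path of an edge does not depend on its orientation
    (∀ a b (h : G.Adj a b), P b a h.symm = (P a b h).reverse) ∧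
    -- no branch vertex is an internal vertex of a path
    (∀ a b (h : G.Adj a b) (c : W), f c ∈ (P a b h).support → c = a ∨ c = b) ∧
    -- paths of different edges meet in branch vertices only
    (∀ a b (h : G.Adj a b) c d (h' : G.Adj c d), s(a, b) ≠ s(c, d) →
      ∀ x, x ∈ (P a b h).support → x ∈ (P c d h').support → x ∈ Set.range f) ∧
    -- all vertices and edges of `H` are used
    (∀ x : V, x ∈ Set.range f ∨ ∃ a b, ∃ h : G.Adj a b, x ∈ (P a b h).support) ∧
    (∀ e ∈ H.edgeSet, ∃ a b, ∃ h : G.Adj a b, e ∈ (P a b h).edges)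

/-- `LeafDeletion G S`: the induced subgraph of `G` on `S` arises from `G` by successively deleting
vertices that have degree one in the current graph. -/
inductive LeafDeletion {V : Type*} (G : SimpleGraph V) : Set V → Prop
  | start : LeafDeletion G Set.univ
  | delete (S : Set V) (v : V) : LeafDeletion G S → v ∈ S → (G.neighborSet v ∩ S).ncard = 1 →
      LeafDeletion G (S \ {v})

/-- The induced subgraph of `G` on `S` is a final result of successively deleting vertices of degree
one: no vertex of degree one is left. -/
def IsLeaflessCore {V : Type*} (G : SimpleGraph V) (S : Set V) : Prop :=
  LeafDeletion G S ∧ ∀ v ∈ S, (G.neighborSet v ∩ S).ncard ≠ 1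

/-- `M` is a reduced core of the finite graph `G`: it has the minimum number of edges among all
graphs of which the leafless core of `G` is a subdivision. -/
def IsReducedCore {V W : Type*} (G : SimpleGraph V) (M : SimpleGraph W) : Prop :=
  ∃ S : Set V, IsLeaflessCore G S ∧ IsSubdivision (G.induce S) M ∧
    ∀ (k : ℕ) (N : SimpleGraph (Fin k)), IsSubdivision (G.induce S) N →
      M.edgeSet.ncard ≤ N.edgeSet.ncard

end DisjointCycles

/-! Three vertices `a`, `b`, `c` such that every cycle contains at least two of them certify that no
two cycles are disjoint. The heart of the proof is a converse for dense graphs: with at least `2n -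
1` edges and no two disjoint cycles, such a triple exists, unless no pair of vertices hits all
cycles and there are at most `n + 5` edges (`K_5` is an example). For `n ≥ 7` the exception is
impossible, since `2n - 1 ≥ n + 6`. This is `exists_isTripleHit_or`, by induction on vertices plus
edges. If all degrees are at least four, an edge can be deleted. Otherwise a vertex `v` of degree at
most three is removed and some of the loss is made up by new edges from one neighbour `x` of `v` to
others (deletion, suppression or contraction). `IsTripleHit.not_cyc_insert` carries the triple back:
a cycle through `v` with at most one triple vertex would, by density, leave room for a second,
disjoint cycle.

Saturation then fixes the structure. Any edge that keeps the triple valid must already be present,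
so the triple `B` is a triangle and each of its vertices together with the remaining set `A` spans a
tree. Thus `A` is a forest of `k` trees, and every vertex of `B` has exactly one edge to each tree
(`IsTriangleForest`). Counting gives `m = n + 2k`, hence parity, and `m ≥ 2n - 1` gives the range of
`n₀ = k + 3`.

Deleting leaves and suppressing vertices of degree two preserve this structure and `k`. They end
when `A` consists of `k` isolated vertices, each joined to all of `B`, which is the split graph. For
`k ≥ 1` it has minimum degree at least three, so its vertices must be branch vertices, with the same
degrees, in every graph of which the core is a subdivision. The handshake lemma makes its edge
number minimal, and a minimal competitor has the same degrees, which determine a split graph. -/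

namespace DisjointCycles

open Finset SimpleGraph

/-! ### Cycles by counting edges; contraction of an edge at a vertex -/

section
open scoped Classical
variable {V : Type*}

/-- The number of neighbours of `v` in `A`. -/
noncomputable def degIn (G : SimpleGraph V) (v : V) (A : Finset V) : ℕ := #{x ∈ A | G.Adj v x}

/-- The number of edges with both ends in `A`. -/
noncomputable def edgesIn (G : SimpleGraph V) (A : Finset V) : ℕ := #{e ∈ A.sym2 | e ∈ G.edgeSet}

/-- The subgraph induced on `A` contains a cycle. -/
def Cyc (G : SimpleGraph V) (A : Finset V) : Prop := ¬ (G.induce (A : Set V)).IsAcyclic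

theorem degIn_insert_of_adj {G : SimpleGraph V} {u v : V} {A : Finset V} (hv : v ∉ A)
    (h : G.Adj u v) : degIn G u (insert v A) = degIn G u A + 1 := by
  unfold degIn
  rw [filter_insert, if_pos h, card_insert_of_notMem (by simp [hv])]

theorem degIn_insert_of_not_adj {G : SimpleGraph V} {u v : V} {A : Finset V}
    (h : ¬ G.Adj u v) : degIn G u (insert v A) = degIn G u A := by
  unfold degIn
  rw [filter_insert, if_neg h]

theorem degIn_insert_self (G : SimpleGraph V) (v : V) (A : Finset V) :
    degIn G v (insert v A) = degIn G v A := degIn_insert_of_not_adj G.irrefl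

theorem degIn_erase_self (G : SimpleGraph V) (v : V) (A : Finset V) :
    degIn G v (A.erase v) = degIn G v A := by
  unfold degIn
  congr 1
  ext x
  simp only [mem_filter, mem_erase]
  constructor
  · rintro ⟨⟨_, h⟩, h'⟩; exact ⟨h, h'⟩
  · rintro ⟨h, h'⟩; exact ⟨⟨h'.ne', h⟩, h'⟩

theorem degIn_erase_of_not_adj {G : SimpleGraph V} {u v : V} {A : Finset V}
    (h : ¬ G.Adj u v) : degIn G u (A.erase v) = degIn G u A := by
  by_cases hv : v ∈ A
  · conv_rhs => rw [← insert_erase hv]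
    rw [degIn_insert_of_not_adj h]
  · rw [erase_eq_of_notMem hv]

theorem degIn_erase_of_adj {G : SimpleGraph V} {u v : V} {A : Finset V} (hv : v ∈ A)
    (h : G.Adj u v) : degIn G u (A.erase v) + 1 = degIn G u A := by
  conv_rhs => rw [← insert_erase hv]
  rw [degIn_insert_of_adj (by simp) h]

theorem degIn_le_erase_add_one (G : SimpleGraph V) (u v : V) (A : Finset V) :
    degIn G u A ≤ degIn G u (A.erase v) + 1 := by
  by_cases h : G.Adj u v
  · by_cases hv : v ∈ A
    · rw [degIn_erase_of_adj hv h]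
    · rw [erase_eq_of_notMem hv]; omega
  · rw [degIn_erase_of_not_adj h]; omega

theorem degIn_insert_le (G : SimpleGraph V) (u v : V) (A : Finset V) :
    degIn G u (insert v A) ≤ degIn G u A + 1 := by
  unfold degIn
  rw [filter_insert]
  split_ifs
  · exact card_insert_le _ _
  · omega

theorem degIn_mono {G H : SimpleGraph V} {u : V} {A B : Finset V} (hAB : A ⊆ B)
    (h : ∀ x ∈ A, G.Adj u x → H.Adj u x) : degIn G u A ≤ degIn H u B := by
  unfold degIn
  refine card_le_card fun x hx => ?_
  simp only [mem_filter] at hx ⊢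
  exact ⟨hAB hx.1, h x hx.1 hx.2⟩

theorem degIn_congr {G H : SimpleGraph V} {u : V} {A : Finset V}
    (h : ∀ x ∈ A, G.Adj u x ↔ H.Adj u x) : degIn G u A = degIn H u A :=
  le_antisymm (degIn_mono le_rfl fun x hx => (h x hx).1) (degIn_mono le_rfl fun x hx => (h x hx).2)

theorem degIn_union {G : SimpleGraph V} {u : V} {A B : Finset V} (h : Disjoint A B) :
    degIn G u (A ∪ B) = degIn G u A + degIn G u B := by
  unfold degIn
  rw [filter_union, card_union_of_disjoint (disjoint_filter_filter h)]

theorem degIn_le_card (G : SimpleGraph V) (u : V) (A : Finset V) : degIn G u A ≤ #A :=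
  card_filter_le _ _

theorem degIn_eq_card {G : SimpleGraph V} {u : V} {A : Finset V} :
    degIn G u A = #A ↔ ∀ x ∈ A, G.Adj u x := card_filter_eq_iff

theorem degIn_pos {G : SimpleGraph V} {u : V} {A : Finset V} :
    0 < degIn G u A ↔ ∃ x ∈ A, G.Adj u x := by
  simp [degIn, card_pos, Finset.Nonempty]

@[simp] theorem degIn_empty (G : SimpleGraph V) (u : V) : degIn G u ∅ = 0 := by simp [degIn]

@[simp] theorem edgesIn_empty (G : SimpleGraph V) : edgesIn G ∅ = 0 := by simp [edgesIn]

theorem edgesIn_insert (G : SimpleGraph V) {v : V} {A : Finset V} (hv : v ∉ A) :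
    edgesIn G (insert v A) = edgesIn G A + degIn G v A := by
  unfold edgesIn degIn
  rw [sym2_insert, filter_union, card_union_of_disjoint, add_comm]
  · congr 1
    rw [filter_image, card_image_of_injective _ (fun a b h => Sym2.congr_right.1 h)]
    rw [filter_insert]
    simp
  · rw [Finset.disjoint_left]
    intro e he he'
    simp only [mem_filter, mem_image] at he he'
    obtain ⟨⟨x, hx, rfl⟩, _⟩ := he
    exact hv (mk_mem_sym2_iff.1 he'.1).1

theorem edgesIn_erase (G : SimpleGraph V) {v : V} {A : Finset V} (hv : v ∈ A) :
    edgesIn G A = edgesIn G (A.erase v) + degIn G v A := by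
  conv_lhs => rw [← insert_erase hv, edgesIn_insert G (by simp), degIn_erase_self]

theorem edgesIn_mono {G H : SimpleGraph V} {A B : Finset V} (hAB : A ⊆ B)
    (h : ∀ x ∈ A, ∀ y ∈ A, G.Adj x y → H.Adj x y) : edgesIn G A ≤ edgesIn H B := by
  unfold edgesIn
  refine card_le_card fun e he => ?_
  induction e with | _ x y
  simp only [mem_filter, mk_mem_sym2_iff, mem_edgeSet] at he ⊢
  exact ⟨⟨hAB he.1.1, hAB he.1.2⟩, h x he.1.1 y he.1.2 he.2⟩

theorem edgesIn_congr {G H : SimpleGraph V} {A : Finset V}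
    (h : ∀ x ∈ A, ∀ y ∈ A, (G.Adj x y ↔ H.Adj x y)) : edgesIn G A = edgesIn H A :=
  le_antisymm (edgesIn_mono le_rfl fun x hx y hy => (h x hx y hy).1)
    (edgesIn_mono le_rfl fun x hx y hy => (h x hx y hy).2)

theorem sum_degIn_insert (G : SimpleGraph V) {v : V} {A : Finset V} (hv : v ∉ A) (U : Finset V) :
    ∑ x ∈ U, degIn G x (insert v A) = ∑ x ∈ U, degIn G x A + degIn G v U := by
  have h : ∀ x ∈ U, degIn G x (insert v A) = degIn G x A + if G.Adj v x then 1 else 0 := by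
    intro x _
    split_ifs with h
    · exact degIn_insert_of_adj hv h.symm
    · exact degIn_insert_of_not_adj fun h' => h h'.symm
  rw [sum_congr rfl h, sum_add_distrib, sum_boole]
  simp [degIn]

theorem sum_degIn (G : SimpleGraph V) (A : Finset V) :
    ∑ v ∈ A, degIn G v A = 2 * edgesIn G A := by
  induction A using Finset.induction with
  | empty => simp
  | insert v A hv ih =>
    rw [sum_insert hv, edgesIn_insert G hv, degIn_insert_self, sum_degIn_insert G hv, ih]
    ring

theorem edgesIn_eq_ncard_induce (G : SimpleGraph V) (A : Finset V) :
    edgesIn G A = (G.induce (A : Set V)).edgeSet.ncard := by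
  rw [← Set.ncard_image_of_injective _ (Sym2.map.injective (Subtype.val_injective (p := (· ∈ (A : Set V))))),
    edgesIn, ← Set.ncard_coe_finset]
  congr 1
  ext e
  induction e with | _ x y
  simp only [coe_filter, mk_mem_sym2_iff, mem_edgeSet, Set.mem_ofPred_eq, Set.mem_image]
  constructor
  · rintro ⟨⟨hx, hy⟩, h⟩
    exact ⟨s(⟨x, hx⟩, ⟨y, hy⟩), h, rfl⟩
  · rintro ⟨e, he, heq⟩
    induction e with | _ p q
    have h : G.Adj p.1 q.1 := he
    have h2 : s(x, y) ∈ G.edgeSet := by rw [← heq]; exact h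
    have h3 : s(x, y) ∈ A.sym2 := by rw [← heq]; exact mk_mem_sym2_iff.2 ⟨p.2, q.2⟩
    exact ⟨mk_mem_sym2_iff.1 h3, h2⟩

theorem Cyc.mono {G H : SimpleGraph V} {A B : Finset V} (hc : Cyc G A) (hAB : A ⊆ B)
    (h : ∀ x ∈ A, ∀ y ∈ A, G.Adj x y → H.Adj x y) : Cyc H B := by
  intro hB
  refine hc (hB.comap ⟨fun x => ⟨x.1, hAB x.2⟩, ?_⟩ ?_)
  · intro x y hxy
    exact h x.1 x.2 y.1 y.2 hxy
  · intro x y hxy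
    exact Subtype.ext (congrArg Subtype.val hxy :)

theorem Cyc.subset {G : SimpleGraph V} {A B : Finset V} (hc : Cyc G A) (hAB : A ⊆ B) : Cyc G B :=
  hc.mono hAB fun _ _ _ _ h => h

/-- An acyclic graph extends to a spanning tree of the complete graph on the same vertices, which
has one edge fewer than vertices. -/
theorem edgesIn_lt_of_not_cyc {G : SimpleGraph V} {A : Finset V} (h : ¬ Cyc G A)
    (hA : A.Nonempty) : edgesIn G A < #A := by
  unfold Cyc at h
  push Not at h
  have : Nonempty (A : Set V) := hA.to_subtype
  obtain ⟨T, hT, _, hTt⟩ :=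
    (connected_top (V := (A : Set V))).exists_isTree_le_of_le_of_isAcyclic le_top h
  have hc := (isTree_iff_connected_and_card.1 hTt).2
  have hle : (G.induce (A : Set V)).edgeSet.ncard ≤ T.edgeSet.ncard :=
    Set.ncard_le_ncard (edgeSet_mono hT) (Set.toFinite _)
  rw [← edgesIn_eq_ncard_induce] at hle
  have hA' : Nat.card (A : Set V) = #A := by simp
  rw [hA', Nat.card_coe_set_eq] at hc
  omega

theorem cyc_of_card_le_edgesIn {G : SimpleGraph V} {A : Finset V} (hA : A.Nonempty)
    (h : #A ≤ edgesIn G A) : Cyc G A := by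
  by_contra hc
  exact absurd (edgesIn_lt_of_not_cyc hc hA) (by omega)

theorem cyc_of_two_le_degIn {G : SimpleGraph V} {A : Finset V} (hA : A.Nonempty)
    (h : ∀ v ∈ A, 2 ≤ degIn G v A) : Cyc G A := by
  refine cyc_of_card_le_edgesIn hA ?_
  have := sum_degIn G A
  have h2 := sum_le_sum h
  simp at h2
  omega

theorem cyc_triangle {G : SimpleGraph V} {x y z : V} (hxy : G.Adj x y) (hxz : G.Adj x z)
    (hyz : G.Adj y z) : Cyc G {x, y, z} := by
  refine cyc_of_card_le_edgesIn (by simp) ?_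
  rw [edgesIn_insert G (by simp [hxy.ne, hxz.ne]), edgesIn_insert G (by simp [hyz.ne]),
    card_eq_three.2 ⟨x, y, z, hxy.ne, hxz.ne, hyz.ne, rfl⟩]
  have h1 : degIn G x {y, z} = 2 := by
    rw [degIn_eq_card.2 (by simp [hxy, hxz]), card_pair hyz.ne]
  have h2 : degIn G y {z} = 1 := by
    rw [degIn_eq_card.2 (by simp [hyz]), card_singleton]
  omega

theorem cyc_iff_exists_copy {G : SimpleGraph V} {A : Finset V} :
    Cyc G A ↔ ∃ n, 3 ≤ n ∧ ∃ f : Copy (cycleGraph n) G, ∀ i, f i ∈ A := by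
  unfold Cyc
  rw [isAcyclic_iff_free_cycleGraph]
  push Not
  constructor
  · rintro ⟨n, hn, h⟩
    obtain ⟨f⟩ := h
    exact ⟨n, hn, (Copy.induce G (A : Set V)).comp f, fun i => (f i).2⟩
  · rintro ⟨n, hn, f, hf⟩
    refine ⟨n, hn, ⟨⟨⟨fun i => ⟨f i, hf i⟩, ?_⟩, ?_⟩⟩⟩
    · intro i j hij
      exact f.toHom.map_adj hij
    · intro i j hij
      exact f.injective (congrArg Subtype.val hij :)

/-- Replaces a cycle by its vertex set and degrees, so that later surgery on cycles is pure edge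
counting. The subgraph `H` is needed because `G` may have chords on `C`. -/
theorem Cyc.exists_two_regular {G : SimpleGraph V} {A : Finset V} (h : Cyc G A) :
    ∃ C ⊆ A, 3 ≤ #C ∧ ∃ H ≤ G, ∀ v ∈ C, degIn H v C = 2 := by
  obtain ⟨n, hn, f, hf⟩ := cyc_iff_exists_copy.1 h
  obtain ⟨n, rfl⟩ : ∃ k, n = k + 3 := ⟨n - 3, by omega⟩
  let g : Fin (n + 3) ↪ V := ⟨f, f.injective⟩
  refine ⟨univ.map g, ?_, by simp, (cycleGraph (n + 3)).map g, ?_, ?_⟩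
  · intro x hx
    simp only [mem_map, mem_univ, true_and] at hx
    obtain ⟨i, rfl⟩ := hx
    exact hf i
  · rw [SimpleGraph.map_le_iff_le_comap]
    intro i j hij
    exact f.toHom.map_adj hij
  · intro v hv
    simp only [mem_map, mem_univ, true_and] at hv
    obtain ⟨i, rfl⟩ := hv
    rw [← cycleGraph_degree_three_le (v := i), ← card_neighborFinset_eq_degree,
      ← card_map g]
    unfold degIn
    congr 1
    ext x
    simp only [mem_filter, mem_map, mem_univ, true_and, mem_neighborFinset]
    constructor
    · rintro ⟨⟨j, rfl⟩, hj⟩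
      exact ⟨j, (SimpleGraph.map_adj_apply (f := g)).1 hj, rfl⟩
    · rintro ⟨j, hj, rfl⟩
      exact ⟨⟨j, rfl⟩, (SimpleGraph.map_adj_apply (f := g)).2 hj⟩

theorem edgesIn_eq_card_of_two_regular {H : SimpleGraph V} {C : Finset V}
    (h : ∀ v ∈ C, degIn H v C = 2) : edgesIn H C = #C := by
  have := sum_degIn H C
  rw [sum_congr rfl h] at this
  simp at this
  omega

/-- `G` together with all edges between `x` and the vertices of `F`. -/
def addStar (G : SimpleGraph V) (x : V) (F : Finset V) : SimpleGraph V where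
  Adj u w := G.Adj u w ∨ (u ≠ w ∧ ((u = x ∧ w ∈ F) ∨ (w = x ∧ u ∈ F)))
  symm := ⟨fun u w h => by
    rcases h with h | ⟨h, h'⟩
    · exact Or.inl h.symm
    · exact Or.inr ⟨h.symm, h'.symm⟩⟩
  loopless := ⟨fun u h => by
    rcases h with h | ⟨h, _⟩
    · exact G.irrefl h
    · exact h rfl⟩

theorem addStar_adj {G : SimpleGraph V} {x : V} {F : Finset V} {u w : V} :
    (addStar G x F).Adj u w ↔
      G.Adj u w ∨ (u ≠ w ∧ ((u = x ∧ w ∈ F) ∨ (w = x ∧ u ∈ F))) := Iff.rfl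

theorem le_addStar (G : SimpleGraph V) (x : V) (F : Finset V) : G ≤ addStar G x F :=
  fun _ _ h => Or.inl h

theorem addStar_empty (G : SimpleGraph V) (x : V) : addStar G x ∅ = G := by
  ext u w; simp [addStar_adj]

theorem addStar_adj_iff_of_ne {G : SimpleGraph V} {x : V} {F : Finset V} {u w : V} (hu : u ≠ x)
    (hw : w ≠ x) : (addStar G x F).Adj u w ↔ G.Adj u w := by
  simp [addStar_adj, hu, hw]

theorem degIn_addStar {G : SimpleGraph V} {x : V} {F A : Finset V} (hFA : F ⊆ A) (hx : x ∉ F)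
    (hF : ∀ y ∈ F, ¬ G.Adj x y) : degIn (addStar G x F) x A = degIn G x A + #F := by
  unfold degIn
  rw [← card_union_of_disjoint]
  · congr 1
    ext w
    simp only [mem_filter, mem_union, addStar_adj]
    constructor
    · rintro ⟨hw, h | ⟨hne, h | h⟩⟩
      · exact Or.inl ⟨hw, h⟩
      · exact Or.inr h.2
      · exact absurd h.2 hx
    · rintro (h | h)
      · exact ⟨h.1, Or.inl h.2⟩
      · exact ⟨hFA h, Or.inr ⟨fun e => hx (e ▸ h), by simpa using Or.inl h⟩⟩
  · rw [Finset.disjoint_left]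
    intro w hw hw'
    exact hF w hw' (mem_filter.1 hw).2

theorem edgesIn_addStar {G : SimpleGraph V} {x : V} {F A : Finset V} (hxA : x ∈ A) (hFA : F ⊆ A)
    (hx : x ∉ F) (hF : ∀ y ∈ F, ¬ G.Adj x y) :
    edgesIn (addStar G x F) A = edgesIn G A + #F := by
  rw [edgesIn_erase _ hxA, edgesIn_erase G hxA, degIn_addStar hFA hx hF]
  have : edgesIn (addStar G x F) (A.erase x) = edgesIn G (A.erase x) :=
    edgesIn_congr fun u hu w hw => addStar_adj_iff_of_ne (ne_of_mem_erase hu) (ne_of_mem_erase hw)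
  omega

/-- A cycle after the contraction of the edge `vx` comes from a cycle through `v` or not. -/
theorem Cyc.of_addStar {G : SimpleGraph V} {v x : V} {F C : Finset V} (hv : v ∉ C)
    (hF : ∀ y ∈ F, G.Adj v y) (hvx : G.Adj v x) (h : Cyc (addStar G x F) C) :
    Cyc G C ∨ (x ∈ C ∧ Cyc G (insert v C)) := by
  obtain ⟨D, hDC, hD3, H, hH, hD⟩ := h.exists_two_regular
  have hDne : D.Nonempty := card_pos.1 (by omega)
  have hDe := edgesIn_eq_card_of_two_regular hD
  have hle : #D ≤ edgesIn (addStar G x F) D :=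
    hDe ▸ edgesIn_mono le_rfl fun _ _ _ _ h => hH h
  by_cases hx : x ∈ D
  · right
    refine ⟨hDC hx, Cyc.subset (A := insert v D) ?_ (insert_subset_insert _ hDC)⟩
    -- Uncontracting: each new edge from `x` to a vertex of `D` is traded for the edge from `v` to
    -- it, and `vx` is one more edge, which pays for the additional vertex `v`.
    refine cyc_of_card_le_edgesIn (by simp) ?_
    have hvD : v ∉ D := fun h => hv (hDC h)
    rw [edgesIn_insert G hvD, card_insert_of_notMem hvD, edgesIn_erase G hx,
      ← degIn_erase_of_adj hx hvx]
    rw [edgesIn_erase _ hx] at hle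
    have h1 : edgesIn (addStar G x F) (D.erase x) = edgesIn G (D.erase x) :=
      edgesIn_congr fun u hu w hw =>
        addStar_adj_iff_of_ne (ne_of_mem_erase hu) (ne_of_mem_erase hw)
    have h2 : degIn (addStar G x F) x D ≤ degIn G x D + degIn G v (D.erase x) := by
      unfold degIn
      refine le_trans (card_le_card ?_) (card_union_le _ _)
      intro w hw
      simp only [mem_filter, mem_union, mem_erase, addStar_adj] at hw ⊢
      rcases hw with ⟨hw, h | ⟨hne, h | h⟩⟩
      · exact Or.inl ⟨hw, h⟩
      · exact Or.inr ⟨⟨hne.symm, hw⟩, hF w h.2⟩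
      · exact absurd h.1.symm hne
    omega
  · left
    refine Cyc.subset (A := D) ?_ hDC
    refine cyc_of_card_le_edgesIn hDne (hle.trans ?_)
    exact edgesIn_mono le_rfl fun u hu w hw h =>
      (addStar_adj_iff_of_ne (ne_of_mem_of_not_mem hu hx) (ne_of_mem_of_not_mem hw hx)).1 h

end

/-! ### Triples meeting every cycle twice, and their transfer through a reduction -/

section
open scoped Classical
variable {V : Type*}

/-- There are no two disjoint cycles inside `S`. -/
def NoTwoCycles (G : SimpleGraph V) (S : Finset V) : Prop :=
  ∀ A ⊆ S, ∀ B ⊆ S, Disjoint A B → Cyc G A → ¬ Cyc G B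

/-- Every cycle inside `S` contains at least two of the three vertices `a`, `b`, `c`. -/
structure IsTripleHit (G : SimpleGraph V) (S : Finset V) (a b c : V) : Prop where
  hab : a ≠ b
  hac : a ≠ c
  hbc : b ≠ c
  ha : a ∈ S
  hb : b ∈ S
  hc : c ∈ S
  not_cyc_ab : ¬ Cyc G (S \ {a, b})
  not_cyc_ac : ¬ Cyc G (S \ {a, c})
  not_cyc_bc : ¬ Cyc G (S \ {b, c})

theorem IsTripleHit.swap {G : SimpleGraph V} {S : Finset V} {a b c : V}
    (h : IsTripleHit G S a b c) : IsTripleHit G S b a c :=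
  ⟨h.hab.symm, h.hbc, h.hac, h.hb, h.ha, h.hc, pair_comm a b ▸ h.not_cyc_ab, h.not_cyc_bc,
    h.not_cyc_ac⟩

theorem IsTripleHit.rotate {G : SimpleGraph V} {S : Finset V} {a b c : V}
    (h : IsTripleHit G S a b c) : IsTripleHit G S b c a :=
  ⟨h.hbc, h.hab.symm, h.hac.symm, h.hb, h.hc, h.ha, h.not_cyc_bc, pair_comm a b ▸ h.not_cyc_ab,
    pair_comm a c ▸ h.not_cyc_ac⟩

theorem NoTwoCycles.mono {G H : SimpleGraph V} {S T : Finset V} (h : NoTwoCycles G S) (hTS : T ⊆ S)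
    (hle : ∀ x ∈ T, ∀ y ∈ T, H.Adj x y → G.Adj x y) : NoTwoCycles H T :=
  fun A hA B hB hAB hcA hcB => h A (hA.trans hTS) B (hB.trans hTS) hAB
    (hcA.mono le_rfl fun x hx y hy => hle x (hA hx) y (hA hy))
    (hcB.mono le_rfl fun x hx y hy => hle x (hB hx) y (hB hy))

/-- In a dense set a cycle survives the deletion of `a` and of a set `T` with few edges to the
other two vertices. -/
theorem cyc_sdiff_of_edgesIn {G : SimpleGraph V} {S T : Finset V} {a b c : V} (hab : a ≠ b)
    (hac : a ≠ c) (hbc : b ≠ c) (ha : a ∈ S) (hb : b ∈ S) (hc : c ∈ S)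
    (hU : ¬ Cyc G (S \ {b, c})) (hT : T ⊆ S \ {a, b, c})
    (h : 2 * #S + degIn G b T + degIn G c T < edgesIn G S + #T + 3) :
    Cyc G (S \ insert a T) := by
  by_contra hR
  obtain ⟨U, hUdef⟩ : ∃ U, U = S \ {a, b, c} := ⟨_, rfl⟩
  obtain ⟨W, hWdef⟩ : ∃ W, W = U \ T := ⟨_, rfl⟩
  rw [← hUdef] at hT
  have haU : a ∉ U := by simp [hUdef]
  have hbU : b ∉ U := by simp [hUdef]
  have hcU : c ∉ U := by simp [hUdef]
  have hS : S = insert a (insert b (insert c U)) := by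
    ext x; simp only [hUdef, mem_insert, mem_sdiff, mem_singleton]; grind
  have hTW : U = T ∪ W := by rw [hWdef, union_sdiff_of_subset hT]
  have hdisj : Disjoint T W := by rw [hWdef]; exact disjoint_sdiff
  have hcW : c ∉ W := fun h => hcU (by rw [hTW]; exact mem_union_right _ h)
  have hbW : b ∉ W := fun h => hbU (by rw [hTW]; exact mem_union_right _ h)
  have hcT : c ∉ T := fun h => hcU (hT h)
  have hRe : S \ insert a T = insert b (insert c W) := by
    ext x; simp only [hUdef, hWdef, mem_insert, mem_sdiff, mem_singleton]
    have := @hT x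
    grind
  have hUe : S \ {b, c} = insert a U := by
    ext x; simp only [hUdef, mem_insert, mem_sdiff, mem_singleton]; grind
  rw [hRe] at hR
  rw [hUe] at hU
  -- If the claim failed, both `U ∪ {a}` and `W ∪ {b, c}` would be forests. They cover all edges of
  -- `S` except possibly `ab`, `ac` and the edges from `b` and `c` to `T`, too few for the assumed
  -- density.
  have e1 := edgesIn_lt_of_not_cyc hU (by simp)
  have e2 := edgesIn_lt_of_not_cyc hR (by simp)
  have hb' : b ∉ insert c W := by simp [hbc, hbW]
  have hb'' : b ∉ insert c U := by simp [hbc, hbU]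
  have ha'' : a ∉ insert b (insert c U) := by simp [hab, hac, haU]
  rw [edgesIn_insert G haU, card_insert_of_notMem haU] at e1
  rw [edgesIn_insert G hb', edgesIn_insert G hcW, card_insert_of_notMem hb',
    card_insert_of_notMem hcW] at e2
  have hcardS : #S = #U + 3 := by
    rw [hS, card_insert_of_notMem ha'', card_insert_of_notMem hb'', card_insert_of_notMem hcU]
  have hcardU : #U = #T + #W := by rw [hTW, card_union_of_disjoint hdisj]
  have e3 : edgesIn G S = edgesIn G U + degIn G c U + degIn G b (insert c U)
      + degIn G a (insert b (insert c U)) := by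
    conv_lhs => rw [hS]
    rw [edgesIn_insert G ha'', edgesIn_insert G hb'', edgesIn_insert G hcU]
  have e4 := degIn_insert_le G a b (insert c U)
  have e5 := degIn_insert_le G a c U
  have e6 : degIn G c U = degIn G c T + degIn G c W := by rw [hTW, degIn_union hdisj]
  have e7 : degIn G b (insert c U) = degIn G b T + degIn G b (insert c W) := by
    rw [hTW, ← union_insert, degIn_union]
    rw [disjoint_insert_right]
    exact ⟨hcT, hdisj⟩
  omega

theorem degIn_add_edgesIn_le {G : SimpleGraph V} {S T : Finset V} {a : V} (hS : ¬ Cyc G S)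
    (hT : insert a T ⊆ S) (ha : a ∉ T) : edgesIn G T + degIn G a T ≤ #T := by
  have := edgesIn_lt_of_not_cyc (fun h => hS (Cyc.subset h hT)) (by simp)
  rw [edgesIn_insert G ha, card_insert_of_notMem ha] at this
  omega

/-- Reversing the deletion of a vertex `v` of degree at most three whose neighbours have been
joined by the edges from `x` to `F`. -/
theorem IsTripleHit.not_cyc_insert {G : SimpleGraph V} {S F : Finset V} {v x a b c : V}
    (hv : v ∉ S) (hF : ∀ y ∈ F, G.Adj v y) (hx : F.Nonempty → G.Adj v x)
    (hN : degIn G v S ≤ 3)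
    (h4 : (∀ p ∈ S, ∀ q ∈ S, G.Adj v p → G.Adj v q → p ≠ q → (addStar G x F).Adj p q) ∨
      2 * #S ≤ edgesIn (addStar G x F) S)
    (h5 : 2 * #S ≤ edgesIn (addStar G x F) S + 1) (hno : NoTwoCycles G (insert v S))
    (hst : IsTripleHit (addStar G x F) S a b c) : ¬ Cyc G (insert v S \ {a, c}) := by
  intro hcyc
  obtain ⟨C, hCS, hC3, H, hH, hC⟩ := hcyc.exists_two_regular
  have hCe := edgesIn_eq_card_of_two_regular hC
  have hCne : C.Nonempty := card_pos.1 (by omega)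
  have hCcyc : Cyc G C := cyc_of_card_le_edgesIn hCne
    (hCe ▸ edgesIn_mono le_rfl fun _ _ _ _ h => hH h)
  have hCv : ∀ y ∈ C, y ≠ v → y ∈ S \ {a, c} := by
    intro y hy hyv
    have := hCS hy
    simp only [mem_sdiff, mem_insert] at this ⊢
    exact ⟨this.1.resolve_left hyv, this.2⟩
  have hvC : v ∈ C := by
    by_contra hvC
    refine hst.not_cyc_ac (hCcyc.mono ?_ fun _ _ _ _ h => le_addStar _ _ _ h)
    exact fun y hy => hCv y hy fun e => hvC (e ▸ hy)
  obtain ⟨p, q, hpq, hpqe⟩ := card_eq_two.1 (hC v hvC)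
  have hpm : p ∈ C ∧ H.Adj v p := by
    have : p ∈ ({p, q} : Finset V) := by simp
    rw [← hpqe] at this
    simpa using this
  have hqm : q ∈ C ∧ H.Adj v q := by
    have : q ∈ ({p, q} : Finset V) := by simp
    rw [← hpqe] at this
    simpa using this
  have hp : p ∈ S \ {a, c} := hCv p hpm.1 hpm.2.ne'
  have hq : q ∈ S \ {a, c} := hCv q hqm.1 hqm.2.ne'
  have hvp := hH hpm.2
  have hvq := hH hqm.2
  have hpS := (mem_sdiff.1 hp).1
  have hqS := (mem_sdiff.1 hq).1
  have havS : ∀ y ∈ S, y ≠ v := fun y hy e => hv (e ▸ hy)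
  -- Both ends of a new edge are neighbours of `v`. A new edge avoiding `p` and `q` would therefore
  -- give `v` four neighbours.
  have key : ∀ R ⊆ S, p ∉ R → q ∉ R → Cyc (addStar G x F) R → Cyc G R := by
    intro R hR hpR hqR hRc
    refine hRc.mono le_rfl ?_
    intro u hu w hw huw
    by_contra hnot
    have hadj : G.Adj v u ∧ G.Adj v w := by
      rcases huw with h | ⟨hne, ⟨h1, h2⟩ | ⟨h1, h2⟩⟩
      · exact absurd h hnot
      · exact ⟨h1 ▸ hx ⟨w, h2⟩, hF w h2⟩
      · exact ⟨hF u h2, h1 ▸ hx ⟨u, h2⟩⟩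
    have hsub : ({u, w, p, q} : Finset V) ⊆ S.filter (G.Adj v) := by
      intro y hy
      simp only [mem_insert, mem_singleton] at hy
      rw [mem_filter]
      rcases hy with rfl | rfl | rfl | rfl
      · exact ⟨hR hu, hadj.1⟩
      · exact ⟨hR hw, hadj.2⟩
      · exact ⟨hpS, hvp⟩
      · exact ⟨hqS, hvq⟩
    have hcard : #({u, w, p, q} : Finset V) = 4 := by
      have h1 : u ≠ w := huw.ne
      have h2 : u ≠ p := fun e => hpR (e ▸ hu)
      have h3 : u ≠ q := fun e => hqR (e ▸ hu)
      have h4 : w ≠ p := fun e => hpR (e ▸ hw)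
      have h5 : w ≠ q := fun e => hqR (e ▸ hw)
      rw [card_insert_of_notMem (by simp [h1, h2, h3]), card_insert_of_notMem (by simp [h4, h5]),
        card_pair hpq]
    have : _ ≤ degIn G v S := card_le_card hsub
    omega
  -- The density bound, with `b` as the deleted vertex of the triple, yields a cycle outside `T ∪
  -- {b}`. It avoids `p` and `q`, so it lives in `G`, and it is disjoint from the cycle in `D`.
  have final : ∀ D T, Cyc G D → v ∈ D → D ⊆ insert v (insert b T) → p ∈ insert b T →
      q ∈ insert b T → T ⊆ S \ {a, b, c} →
      2 * #S + degIn (addStar G x F) a T + degIn (addStar G x F) c T <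
        edgesIn (addStar G x F) S + #T + 3 → False := by
    intro D T hD hvD hDT hpT hqT hTS hlt
    have hR := cyc_sdiff_of_edgesIn hst.hab.symm hst.hbc hst.hac hst.hb hst.ha hst.hc
      hst.not_cyc_ac (T := T) (by rwa [Finset.insert_comm b a]) hlt
    have hR' := key _ sdiff_subset (by simp only [mem_sdiff, not_and, not_not]; exact fun _ => hpT)
      (by simp only [mem_sdiff, not_and, not_not]; exact fun _ => hqT) hR
    refine hno D ?_ _ (sdiff_subset.trans (subset_insert _ _)) ?_ hD hR'
    · refine hDT.trans (insert_subset_insert _ (insert_subset hst.hb ?_))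
      exact hTS.trans sdiff_subset
    · rw [Finset.disjoint_left]
      intro y hy hy'
      rw [mem_sdiff] at hy'
      rcases mem_insert.1 (hDT hy) with h | h
      · exact hv (h ▸ hy'.1)
      · exact hy'.2 h
  -- `T` with one vertex of the triple is a forest, so many edges inside `T` leave few from `a` or
  -- `c` to `T`.
  have hTacyc : ∀ T ⊆ S \ {a, b, c}, ∀ y, (y = a ∨ y = c) →
      edgesIn (addStar G x F) T + degIn (addStar G x F) y T ≤ #T := by
    intro T hT y hy
    have hT' : ∀ z ∈ T, z ∈ S ∧ z ≠ a ∧ z ≠ b ∧ z ≠ c := by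
      intro z hz
      simpa using hT hz
    rcases hy with rfl | rfl
    · refine degIn_add_edgesIn_le hst.not_cyc_bc ?_ fun h => (hT' _ h).2.1 rfl
      intro z hz
      rcases mem_insert.1 hz with rfl | hz
      · simp [hst.hab, hst.hac, hst.ha]
      · simp [hT' z hz]
    · refine degIn_add_edgesIn_le hst.not_cyc_ab ?_ fun h => (hT' _ h).2.2.2 rfl
      intro z hz
      rcases mem_insert.1 hz with rfl | hz
      · simp [hst.hac.symm, hst.hbc.symm, hst.hc]
      · simp [hT' z hz]
  simp only [mem_sdiff, mem_insert, mem_singleton, not_or] at hp hq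
  -- Three cases: `pq` is an edge of `G` and the triangle `vpq` serves as first cycle; `pq` is a new
  -- edge and shortcuts `C` past `v`, against the triple in the reduced graph; or `pq` is no edge at
  -- all, and `C` itself serves, at the price of the stronger density bound.
  by_cases hGpq : G.Adj p q
  · have hD : Cyc G {v, p, q} := cyc_triangle hvp hvq hGpq
    obtain ⟨T, hT⟩ : ∃ T, T = ({p, q} : Finset V).erase b := ⟨_, rfl⟩
    have hTS : T ⊆ S \ {a, b, c} := by
      intro z hz
      simp only [hT, mem_erase, mem_insert, mem_singleton] at hz
      simp only [mem_sdiff, mem_insert, mem_singleton, not_or]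
      rcases hz.2 with rfl | rfl
      · exact ⟨hp.1, hp.2.1, hz.1, hp.2.2⟩
      · exact ⟨hq.1, hq.2.1, hz.1, hq.2.2⟩
    have h1 := hTacyc T hTS a (Or.inl rfl)
    have h2 := hTacyc T hTS c (Or.inr rfl)
    have hT1 : 1 ≤ #T := by
      have := pred_card_le_card_erase (a := b) (s := ({p, q} : Finset V))
      rw [card_pair hpq] at this
      rw [hT]; omega
    have hTe : #T ≤ edgesIn (addStar G x F) T + 1 := by
      by_cases hb : b ∈ ({p, q} : Finset V)
      · have : #T = 1 := by rw [hT, card_erase_of_mem hb, card_pair hpq]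
        omega
      · have : T = {p, q} := by rw [hT, erase_eq_of_notMem hb]
        rw [this, card_pair hpq, edgesIn_insert _ (by simpa using hpq)]
        have : degIn (addStar G x F) p {q} = 1 := by
          rw [degIn_eq_card.2 (by simp [le_addStar G x F hGpq]), card_singleton]
        omega
    have hbT : insert b T = insert b {p, q} := by ext y; by_cases hy : y = b <;> simp [hT, hy]
    refine final _ T hD (by simp) ?_ ?_ ?_ hTS (by omega)
    · rw [hbT]; exact insert_subset_insert _ (subset_insert _ _)
    · rw [hbT]; simp
    · rw [hbT]; simp
  have hCve : edgesIn H (C.erase v) + 2 = #C := by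
    rw [← hCe, edgesIn_erase H hvC, hC v hvC]
  have hCvS : C.erase v ⊆ S \ {a, c} := fun y hy => hCv y (mem_of_mem_erase hy) (ne_of_mem_erase hy)
  have hcardCv : #(C.erase v) + 1 = #C := card_erase_add_one hvC
  by_cases hG'pq : (addStar G x F).Adj p q
  · refine hst.not_cyc_ac (Cyc.subset (A := C.erase v) ?_ hCvS)
    refine cyc_of_card_le_edgesIn (card_pos.1 (by omega)) ?_
    have hpC : p ∈ C.erase v := mem_erase.2 ⟨hvp.ne', hpm.1⟩
    have hqC : q ∈ (C.erase v).erase p := by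
      simp only [mem_erase]; exact ⟨hpq.symm, hvq.ne', hqm.1⟩
    rw [edgesIn_erase _ hpC, ← degIn_erase_self] at hCve ⊢
    have h1 : edgesIn H ((C.erase v).erase p) ≤ edgesIn (addStar G x F) ((C.erase v).erase p) :=
      edgesIn_mono le_rfl fun _ _ _ _ h => le_addStar _ _ _ (hH h)
    have h2 : degIn H p ((C.erase v).erase p) + 1 ≤
        degIn (addStar G x F) p ((C.erase v).erase p) := by
      rw [← degIn_erase_of_adj hqC hG'pq]
      have : ¬ H.Adj p q := fun h => hGpq (hH h)
      rw [← degIn_erase_of_not_adj this]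
      have := degIn_mono (u := p) (le_refl (((C.erase v).erase p).erase q))
        (fun y _ h => le_addStar G x F (hH h) : ∀ y ∈ _, H.Adj p y → _)
      omega
    omega
  · have h6 : 2 * #S ≤ edgesIn (addStar G x F) S := by
      rcases h4 with h4 | h4
      · exact absurd (h4 p hpS q hqS hvp hvq hpq) hG'pq
      · exact h4
    have hC4 : 4 ≤ #C := by
      by_contra hlt
      have hpe : C.filter (H.Adj p) = C.erase p := by
        refine eq_of_subset_of_card_le ?_ ?_
        · intro y hy
          rw [mem_filter] at hy
          exact mem_erase.2 ⟨hy.2.ne', hy.1⟩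
        · have := hC p hpm.1
          unfold degIn at this
          rw [this, card_erase_of_mem hpm.1]; omega
      have : q ∈ C.filter (H.Adj p) := by rw [hpe]; exact mem_erase.2 ⟨hpq.symm, hqm.1⟩
      exact hGpq (hH (mem_filter.1 this).2)
    obtain ⟨T, hT⟩ : ∃ T, T = (C.erase v).erase b := ⟨_, rfl⟩
    have hTS : T ⊆ S \ {a, b, c} := by
      intro z hz
      rw [hT] at hz
      have := hCvS (mem_of_mem_erase hz)
      simp only [mem_sdiff, mem_insert, mem_singleton, not_or] at this ⊢
      exact ⟨this.1, this.2.1, ne_of_mem_erase hz, this.2.2⟩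
    have h1 := hTacyc T hTS a (Or.inl rfl)
    have h2 := hTacyc T hTS c (Or.inr rfl)
    -- Removing `v` and possibly `b` from a cycle leaves at most two paths.
    have hTe : #T ≤ edgesIn (addStar G x F) T + 2 ∧ 2 ≤ #T := by
      have hle : edgesIn H T ≤ edgesIn (addStar G x F) T :=
        edgesIn_mono le_rfl fun _ _ _ _ h => le_addStar _ _ _ (hH h)
      by_cases hbC : b ∈ C.erase v
      · have e1 := edgesIn_erase H hbC
        rw [← hT] at e1
        have e2 : degIn H b (C.erase v) ≤ 2 := by
          rw [← hC b (mem_of_mem_erase hbC)]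
          exact degIn_mono (erase_subset _ _) fun _ _ h => h
        have e3 : #T + 1 = #(C.erase v) := by rw [hT, card_erase_add_one hbC]
        omega
      · have : T = C.erase v := by rw [hT, erase_eq_of_notMem hbC]
        rw [this] at hle ⊢
        omega
    have hbT : insert b T = insert b (C.erase v) := by ext y; by_cases hy : y = b <;> simp [hT, hy]
    refine final C T hCcyc hvC ?_ ?_ ?_ hTS (by omega)
    · intro y hy
      rw [hbT]
      by_cases hyv : y = v
      · simp [hyv]
      · simp [hyv, hy]
    · rw [hbT]; simp [hvp.ne', hpm.1]
    · rw [hbT]; simp [hvq.ne', hqm.1]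

theorem IsTripleHit.of_addStar {G : SimpleGraph V} {S F : Finset V} {v x a b c : V}
    (hv : v ∉ S) (hF : ∀ y ∈ F, G.Adj v y) (hx : F.Nonempty → G.Adj v x)
    (hN : degIn G v S ≤ 3)
    (h4 : (∀ p ∈ S, ∀ q ∈ S, G.Adj v p → G.Adj v q → p ≠ q → (addStar G x F).Adj p q) ∨
      2 * #S ≤ edgesIn (addStar G x F) S)
    (h5 : 2 * #S ≤ edgesIn (addStar G x F) S + 1) (hno : NoTwoCycles G (insert v S))
    (hst : IsTripleHit (addStar G x F) S a b c) : IsTripleHit G (insert v S) a b c where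
  hab := hst.hab
  hac := hst.hac
  hbc := hst.hbc
  ha := mem_insert_of_mem hst.ha
  hb := mem_insert_of_mem hst.hb
  hc := mem_insert_of_mem hst.hc
  not_cyc_ab := pair_comm b a ▸ hst.rotate.not_cyc_insert hv hF hx hN h4 h5 hno
  not_cyc_ac := hst.not_cyc_insert hv hF hx hN h4 h5 hno
  not_cyc_bc := hst.swap.not_cyc_insert hv hF hx hN h4 h5 hno

end

/-! ### Existence of a triple in dense sets -/

section
open scoped Classical
variable {V : Type*}

theorem degIn_lt_card {G : SimpleGraph V} {v : V} {S : Finset V} (hv : v ∈ S) :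
    degIn G v S < #S := by
  rw [← degIn_erase_self, ← card_erase_add_one hv]
  exact Nat.lt_succ_of_le (degIn_le_card _ _ _)

/-- Of two disjoint cycles only one can contain `x`, so at most one of them needs `v` when it is
lifted back to `G`. -/
theorem NoTwoCycles.addStar {G : SimpleGraph V} {S F : Finset V} {v x : V}
    (hv : v ∉ S) (hF : ∀ y ∈ F, G.Adj v y) (hx : F.Nonempty → G.Adj v x)
    (h : NoTwoCycles G (insert v S)) : NoTwoCycles (addStar G x F) S := by
  rcases F.eq_empty_or_nonempty with rfl | hne
  · rw [addStar_empty]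
    exact h.mono (subset_insert _ _) fun _ _ _ _ h => h
  intro A hA B hB hAB hcA hcB
  have hvA : v ∉ A := fun h => hv (hA h)
  have hvB : v ∉ B := fun h => hv (hB h)
  have hA' := hA.trans (subset_insert v S)
  have hB' := hB.trans (subset_insert v S)
  rcases hcA.of_addStar hvA hF (hx hne) with h1 | ⟨hxA, h1⟩ <;>
    rcases hcB.of_addStar hvB hF (hx hne) with h2 | ⟨hxB, h2⟩
  · exact h A hA' B hB' hAB h1 h2
  · exact h A hA' _ (insert_subset_insert v hB) (disjoint_insert_right.2 ⟨hvA, hAB⟩) h1 h2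
  · exact h _ (insert_subset_insert v hA) B hB' (disjoint_insert_left.2 ⟨hvB, hAB⟩) h1 h2
  · exact Finset.disjoint_left.1 hAB hxA hxB

/-- No two vertices hit all the cycles inside `S`. -/
def NoPairHits (G : SimpleGraph V) (S : Finset V) : Prop := ∀ p q, Cyc G (S \ {p, q})

theorem Cyc.of_addStar_of_notMem {G : SimpleGraph V} {C F : Finset V} {x : V}
    (h : Cyc (addStar G x F) C) (hx : x ∉ C) : Cyc G C :=
  h.mono le_rfl fun _ hu _ hw h => (addStar_adj_iff_of_ne (ne_of_mem_of_not_mem hu hx)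
    (ne_of_mem_of_not_mem hw hx)).1 h

/-- For a pair containing `v`, apply the hypothesis with `x` in place of `v`: a cycle avoiding `x`
uses no new edge. Other pairs are handled by lifting the cycle. -/
theorem NoPairHits.of_addStar {G : SimpleGraph V} {S F : Finset V} {v x : V}
    (hv : v ∉ S) (hF : ∀ y ∈ F, G.Adj v y) (hx : F.Nonempty → G.Adj v x)
    (h : NoPairHits (addStar G x F) S) : NoPairHits G (insert v S) := by
  rcases F.eq_empty_or_nonempty with rfl | hne
  · rw [addStar_empty] at h
    exact fun p q => (h p q).subset (sdiff_subset_sdiff (subset_insert _ _) le_rfl)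
  have aux : ∀ q, Cyc G (insert v S \ {v, q}) := by
    intro q
    refine ((h x q).of_addStar_of_notMem (by simp)).subset ?_
    intro y hy
    simp only [mem_sdiff, mem_insert, mem_singleton, not_or] at hy ⊢
    exact ⟨Or.inr hy.1, fun e => hv (e ▸ hy.1), hy.2.2⟩
  intro p q
  by_cases hp : p = v
  · exact hp ▸ aux q
  by_cases hq : q = v
  · rw [pair_comm]; exact hq ▸ aux p
  rcases (h p q).of_addStar (fun h => hv (mem_sdiff.1 h).1) hF (hx hne) with h1 | ⟨_, h1⟩
  · exact h1.subset (sdiff_subset_sdiff (subset_insert _ _) le_rfl)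
  · refine h1.subset ?_
    intro y hy
    simp only [mem_sdiff, mem_insert, mem_singleton, not_or] at hy ⊢
    rcases hy with rfl | hy
    · exact ⟨Or.inl rfl, Ne.symm hp, Ne.symm hq⟩
    · exact ⟨Or.inr hy.1, hy.2⟩

/-- The missing edges form a matching, so some split into two triples separates the ends of each of
them and gives two triangles. All ten splits are offered to the final case check. -/
theorem not_noTwoCycles_of_card_six {G : SimpleGraph V} {S : Finset V} (hS : #S = 6)
    (hd : ∀ v ∈ S, 4 ≤ degIn G v S) : ¬ NoTwoCycles G S := by
  intro hno
  let e := S.equivFinOfCardEq hS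
  obtain ⟨f, hf⟩ : ∃ f : Fin 6 → V, f = fun i => (e.symm i).1 := ⟨_, rfl⟩
  have hfS : ∀ i, f i ∈ S := fun i => by rw [hf]; exact (e.symm i).2
  have hfi : ∀ i j, i ≠ j → f i ≠ f j := by
    intro i j hij h
    rw [hf] at h
    exact hij (e.symm.injective (Subtype.ext h))
  have hadj : ∀ i j k, i ≠ j → i ≠ k → j ≠ k → G.Adj (f i) (f j) ∨ G.Adj (f i) (f k) := by
    intro i j k hij hik hjk
    by_contra hcon
    push Not at hcon
    have h1 : degIn G (f i) S = degIn G (f i) (((S.erase (f i)).erase (f j)).erase (f k)) := by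
      rw [degIn_erase_of_not_adj hcon.2, degIn_erase_of_not_adj hcon.1, degIn_erase_self]
    have h2 := degIn_le_card G (f i) (((S.erase (f i)).erase (f j)).erase (f k))
    rw [card_erase_of_mem, card_erase_of_mem, card_erase_of_mem (hfS i), hS] at h2
    · have := hd _ (hfS i)
      omega
    · simp [hfi j i hij.symm, hfS]
    · simp [hfi k i hik.symm, hfi k j hjk.symm, hfS]
  have htri : ∀ i j k l m n, G.Adj (f i) (f j) → G.Adj (f i) (f k) → G.Adj (f j) (f k) →
      G.Adj (f l) (f m) → G.Adj (f l) (f n) → G.Adj (f m) (f n) →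
      (i ≠ l ∧ i ≠ m ∧ i ≠ n ∧ j ≠ l ∧ j ≠ m ∧ j ≠ n ∧ k ≠ l ∧ k ≠ m ∧ k ≠ n) → False := by
    intro i j k l m n h1 h2 h3 h4 h5 h6 h
    refine hno {f i, f j, f k} ?_ {f l, f m, f n} ?_ ?_ (cyc_triangle h1 h2 h3)
      (cyc_triangle h4 h5 h6)
    · simp [insert_subset_iff, hfS]
    · simp [insert_subset_iff, hfS]
    · obtain ⟨a1, a2, a3, a4, a5, a6, a7, a8, a9⟩ := h
      rw [Finset.disjoint_left]
      simp only [mem_insert, mem_singleton]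
      grind
  clear hd hno hfi hfS hf
  have hsym := fun i j => G.adj_comm (f i) (f j)
  have t0 := htri 0 1 2 3 4 5
  have t1 := htri 0 1 3 2 4 5
  have t2 := htri 0 1 4 2 3 5
  have t3 := htri 0 1 5 2 3 4
  have t4 := htri 0 2 3 1 4 5
  have t5 := htri 0 2 4 1 3 5
  have t6 := htri 0 2 5 1 3 4
  have t7 := htri 0 3 4 1 2 5
  have t8 := htri 0 3 5 1 2 4
  have t9 := htri 0 4 5 1 2 3
  clear htri
  grind

theorem edgesIn_deleteEdges {G : SimpleGraph V} {u w : V} {S : Finset V} (hu : u ∈ S) (hw : w ∈ S)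
    (huw : G.Adj u w) : edgesIn (G.deleteEdges {s(u, w)}) S + 1 = edgesIn G S := by
  have hG : addStar (G.deleteEdges {s(u, w)}) u {w} = G := by
    ext x y
    simp only [addStar_adj, deleteEdges_adj, Set.mem_singleton_iff, Finset.mem_singleton,
      Sym2.eq_iff]
    have := huw.ne
    have := huw.symm
    grind
  conv_rhs => rw [← hG]
  rw [edgesIn_addStar hu (by simpa using hw) (by simpa using huw.ne) (by simp), card_singleton]

/-- Let `U` be `S` without the triple. It forms a forest with each triple vertex, so the degrees of
its vertices add up to at most `3 * #U` after the deletion of `uw`. They add up to at least `4 * #U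
- 2`, hence `#U ≤ 2`. -/
theorem card_le_five_of_isTripleHit {G : SimpleGraph V} {S : Finset V} {u w a b c : V}
    (hd : ∀ v ∈ S, 4 ≤ degIn G v S) (h : IsTripleHit (G.deleteEdges {s(u, w)}) S a b c) :
    #S ≤ 5 := by
  obtain ⟨G', hG'⟩ : ∃ G', G' = G.deleteEdges {s(u, w)} := ⟨_, rfl⟩
  rw [← hG'] at h
  obtain ⟨U, hUdef⟩ : ∃ U, U = S \ {a, b, c} := ⟨_, rfl⟩
  have hS : S = insert a (insert b (insert c U)) := by
    ext x; simp only [hUdef, mem_insert, mem_sdiff, mem_singleton]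
    have := h.ha; have := h.hb; have := h.hc
    grind
  have haU : a ∉ U := by simp [hUdef]
  have hbU : b ∉ U := by simp [hUdef]
  have hcU : c ∉ U := by simp [hUdef]
  have hb'' : b ∉ insert c U := by simp [h.hbc, hbU]
  have ha'' : a ∉ insert b (insert c U) := by simp [h.hab, h.hac, haU]
  have hcard : #S = #U + 3 := by
    rw [hS, card_insert_of_notMem ha'', card_insert_of_notMem hb'', card_insert_of_notMem hcU]
  have hsum : ∑ y ∈ U, degIn G' y S =
      2 * edgesIn G' U + degIn G' c U + degIn G' b U + degIn G' a U := by
    conv_lhs => rw [hS]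
    rw [sum_degIn_insert _ ha'', sum_degIn_insert _ hb'', sum_degIn_insert _ hcU, sum_degIn]
  have h1 := degIn_add_edgesIn_le h.not_cyc_bc (T := U) (a := a)
    (by rw [hS]; intro x; simp only [mem_insert, mem_sdiff, mem_singleton]
        have := h.hab; have := h.hac; grind) haU
  have h2 := degIn_add_edgesIn_le h.not_cyc_ac (T := U) (a := b)
    (by rw [hS]; intro x; simp only [mem_insert, mem_sdiff, mem_singleton]
        have := h.hab; have := h.hbc; grind) hbU
  have h3 := degIn_add_edgesIn_le h.not_cyc_ab (T := U) (a := c)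
    (by rw [hS]; intro x; simp only [mem_insert, mem_sdiff, mem_singleton]
        have := h.hac; have := h.hbc; grind) hcU
  have hdeg : ∀ y ∈ U, 4 ≤ degIn G' y S + ((if y = u then 1 else 0) + if y = w then 1 else 0) := by
    intro y hy
    have h4 := hd y (by rw [hS]; simp [hy])
    by_cases hyu : y = u
    · have : degIn G y S ≤ degIn G' y S + 1 := by
        refine (degIn_le_erase_add_one G y w S).trans (Nat.add_le_add_right ?_ 1)
        refine degIn_mono (erase_subset _ _) fun x hx h => ?_
        rw [hG', deleteEdges_adj]
        refine ⟨h, ?_⟩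
        have := ne_of_mem_erase hx
        have := h.ne
        simp only [Set.mem_singleton_iff, Sym2.eq_iff]
        grind
      simp only [hyu, if_true] at this h4 ⊢
      omega
    by_cases hyw : y = w
    · have : degIn G y S ≤ degIn G' y S + 1 := by
        refine (degIn_le_erase_add_one G y u S).trans (Nat.add_le_add_right ?_ 1)
        refine degIn_mono (erase_subset _ _) fun x hx h => ?_
        rw [hG', deleteEdges_adj]
        refine ⟨h, ?_⟩
        have := ne_of_mem_erase hx
        have := h.ne
        simp only [Set.mem_singleton_iff, Sym2.eq_iff]
        grind
      simp only [hyw, if_true] at this h4 ⊢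
      omega
    · have : degIn G y S ≤ degIn G' y S := by
        refine degIn_mono le_rfl fun x hx h => ?_
        rw [hG', deleteEdges_adj]
        refine ⟨h, ?_⟩
        simp only [Set.mem_singleton_iff, Sym2.eq_iff]
        grind
      omega
  have h4 := sum_le_sum hdeg
  rw [sum_add_distrib, sum_add_distrib, hsum, sum_ite_eq', sum_ite_eq', sum_const,
    smul_eq_mul] at h4
  have e1 : (if u ∈ U then 1 else 0) ≤ 1 := by split_ifs <;> omega
  have e2 : (if w ∈ U then 1 else 0) ≤ 1 := by split_ifs <;> omega
  omega

/-- A cycle avoiding two of the three neighbours cannot pass through `v`, so it is disjoint from the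
triangle formed by `v` and these two. -/
theorem isTripleHit_of_clique_neighbors {G : SimpleGraph V} {S : Finset V} {v x y z : V}
    (hno : NoTwoCycles G S) (hv : v ∈ S) (hN : S.filter (G.Adj v) = {x, y, z})
    (hxy : G.Adj x y) (hxz : G.Adj x z) (hyz : G.Adj y z) : IsTripleHit G S x y z := by
  have hmem : ∀ w, w ∈ ({x, y, z} : Finset V) → w ∈ S ∧ G.Adj v w := by
    intro w hw
    rw [← hN] at hw
    exact mem_filter.1 hw
  have hx := hmem x (by simp)
  have hy := hmem y (by simp)
  have hz := hmem z (by simp)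
  have aux : ∀ p q r, p ∈ S → q ∈ S → G.Adj v p → G.Adj v q → G.Adj p q →
      (S.filter (G.Adj v) = {p, q, r}) → ¬ Cyc G (S \ {p, q}) := by
    intro p q r hp hq hvp hvq hpq hN hc
    obtain ⟨C, hCS, hC3, H, hH, hC⟩ := hc.exists_two_regular
    have hCc : Cyc G C := cyc_of_card_le_edgesIn (card_pos.1 (by omega))
      ((edgesIn_eq_card_of_two_regular hC) ▸ edgesIn_mono le_rfl fun _ _ _ _ h => hH h)
    have hCS' : ∀ w ∈ C, w ∈ S ∧ w ≠ p ∧ w ≠ q := by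
      intro w hw; simpa using hCS hw
    have hvC : v ∉ C := by
      intro hvC
      have h2 := hC v hvC
      have : C.filter (H.Adj v) ⊆ {r} := by
        intro w hw
        rw [mem_filter] at hw
        have h3 : w ∈ S.filter (G.Adj v) := mem_filter.2 ⟨(hCS' w hw.1).1, hH hw.2⟩
        rw [hN] at h3
        have := hCS' w hw.1
        simp only [mem_insert, mem_singleton] at h3 ⊢
        grind
      have : degIn H v C ≤ 1 := (card_le_card this).trans (by simp)
      omega
    refine hno {v, p, q} (by simp [insert_subset_iff, hv, hp, hq]) C
      (hCS.trans sdiff_subset) ?_ (cyc_triangle hvp hvq hpq) hCc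
    rw [Finset.disjoint_right]
    intro w hw
    have := hCS' w hw
    have : w ≠ v := fun e => hvC (e ▸ hw)
    simp only [mem_insert, mem_singleton]
    grind
  refine ⟨hxy.ne, hxz.ne, hyz.ne, hx.1, hy.1, hz.1, ?_, ?_, ?_⟩
  · exact aux x y z hx.1 hy.1 hx.2 hy.2 hxy hN
  · exact aux x z y hx.1 hz.1 hx.2 hz.2 hxz (by rw [hN, pair_comm])
  · exact aux y z x hy.1 hz.1 hy.2 hz.2 hyz (by rw [hN]; ext; simp; tauto)

/-- A set without two disjoint cycles and with many edges is hit at least twice by a triple, with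
small exceptions. -/
theorem exists_isTripleHit_or (N : ℕ) : ∀ (G : SimpleGraph V) (S : Finset V),
    edgesIn G S + #S ≤ N → S.Nonempty → NoTwoCycles G S → 2 * #S ≤ edgesIn G S + 1 →
    (∃ a b c, IsTripleHit G S a b c) ∨ (NoPairHits G S ∧ edgesIn G S ≤ #S + 5) := by
  induction N with
  | zero =>
    intro G S h hne
    have := card_pos.2 hne
    omega
  | succ N ih =>
    intro G S hN hne hno hm
    by_cases hmin : ∀ v ∈ S, 4 ≤ degIn G v S
    · have hX : NoPairHits G S := by
        intro p q
        refine cyc_of_two_le_degIn ?_ ?_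
        · obtain ⟨v, hv⟩ := hne
          have h1 := hmin v hv
          have h2 := degIn_lt_card (G := G) hv
          refine card_pos.1 ?_
          have := le_card_sdiff {p, q} S
          have := card_le_two (a := p) (b := q)
          omega
        · intro v hv
          have h1 := hmin v (mem_sdiff.1 hv).1
          have h2 := degIn_le_erase_add_one G v p S
          have h3 := degIn_le_erase_add_one G v q (S.erase p)
          have h4 : (S.erase p).erase q = S \ {p, q} := by
            ext x; simp only [mem_erase, mem_sdiff, mem_insert, mem_singleton]; tauto
          rw [h4] at h3
          omega
      right
      refine ⟨hX, ?_⟩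
      by_contra hbig
      have hsum := sum_degIn G S
      have h4 := sum_le_sum hmin
      have h5 := sum_le_sum fun v hv => Nat.le_sub_one_of_lt (degIn_lt_card (G := G) (S := S) hv)
      rw [sum_const, smul_eq_mul, hsum] at h4 h5
      -- On at most five vertices even the complete graph has no more than `#S + 5` edges.
      have h6 : 6 ≤ #S := by
        by_contra h6
        have : #S * (#S - 1) ≤ #S * 4 := Nat.mul_le_mul_left _ (by omega)
        omega
      obtain ⟨v, hv⟩ := hne
      obtain ⟨w, hw, hvw⟩ := degIn_pos.1 (lt_of_lt_of_le (by norm_num) (hmin v hv))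
      have he := edgesIn_deleteEdges hv hw hvw
      rcases ih (G.deleteEdges {s(v, w)}) S (by omega) ⟨v, hv⟩
        (hno.mono le_rfl fun _ _ _ _ h => (deleteEdges_le _) h) (by omega) with
        ⟨a, b, c, h⟩ | ⟨_, h⟩
      · have := card_le_five_of_isTripleHit hmin h
        omega
      -- Now there are exactly `#S + 6` edges, while minimum degree four forces at least `2 * #S`;
      -- hence `#S = 6`.
      · exact not_noTwoCycles_of_card_six (by omega) hmin hno
    · push Not at hmin
      obtain ⟨v, hv, hdv⟩ := hmin
      obtain ⟨S', hS'⟩ : ∃ S', S' = S.erase v := ⟨_, rfl⟩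
      have hvS' : v ∉ S' := by simp [hS']
      have hS : insert v S' = S := by rw [hS', insert_erase hv]
      have he := edgesIn_erase G hv
      have hc := card_erase_add_one hv
      have hd' : degIn G v S' = degIn G v S := by rw [hS', degIn_erase_self]
      rw [← hS'] at he hc
      have hne' : S'.Nonempty := by
        by_contra h
        rw [not_nonempty_iff_eq_empty] at h
        rw [h] at he hd' hc
        simp at he hd' hc
        omega
      have hmemN : ∀ w, w ∈ S.filter (G.Adj v) → w ∈ S' ∧ G.Adj v w := by
        intro w hw
        rw [mem_filter] at hw
        exact ⟨hS' ▸ mem_erase.2 ⟨hw.2.ne', hw.1⟩, hw.2⟩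
      -- The reduction loses one vertex and `degIn G v S - #F` edges. A loss of at most two edges
      -- preserves the density hypothesis; a loss of at most one gives the stronger bound needed for
      -- the triple and preserves the bound `#S + 5`. With a loss of two, the neighbours of `v` must
      -- become a clique and the second alternative must be excluded separately.
      have reduce : ∀ (x : V) (F : Finset V), (∀ y ∈ F, G.Adj v y ∧ ¬ G.Adj x y) →
          F ⊆ S' → x ∉ F → (F.Nonempty → x ∈ S' ∧ G.Adj v x) →
          ((∀ p ∈ S', ∀ q ∈ S', G.Adj v p → G.Adj v q → p ≠ q → (addStar G x F).Adj p q) ∨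
            degIn G v S ≤ #F + 1) → degIn G v S ≤ #F + 2 → #F ≤ degIn G v S →
          (degIn G v S ≤ #F + 1 ∨ ¬ NoPairHits (addStar G x F) S') →
          (∃ a b c, IsTripleHit G S a b c) ∨ (NoPairHits G S ∧ edgesIn G S ≤ #S + 5) := by
        intro x F hF hFS hxF hx h4 h5 h5' h6
        have heF : edgesIn (addStar G x F) S' = edgesIn G S' + #F := by
          rcases F.eq_empty_or_nonempty with rfl | hFne
          · simp [addStar_empty]
          · exact edgesIn_addStar (hx hFne).1 hFS hxF fun y hy => (hF y hy).2
        have hno' := hno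
        rw [← hS] at hno'
        rcases ih (addStar G x F) S' (by omega) hne'
          (hno'.addStar hvS' (fun y hy => (hF y hy).1) fun h => (hx h).2) (by omega) with
          ⟨a, b, c, h⟩ | ⟨h, hle⟩
        · left
          refine ⟨a, b, c, hS ▸ h.of_addStar hvS' (fun y hy => (hF y hy).1) (fun h => (hx h).2)
            (by omega) (h4.imp id fun _ => by omega) (by omega) hno'⟩
        · right
          rcases h6 with h6 | h6
          · exact ⟨hS ▸ h.of_addStar hvS' (fun y hy => (hF y hy).1) fun h => (hx h).2, by omega⟩
          · exact absurd h h6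
      -- A cycle avoiding the pair `x`, `y` would be disjoint from the triangle `vxy`; it uses no
      -- new edge because the star is centred at `x` or `y`.
      have triangle : ∀ (x y w : V) (F : Finset V), x ∈ S' → y ∈ S' → G.Adj v x → G.Adj v y →
          G.Adj x y → (w = x ∨ w = y) → ¬ NoPairHits (addStar G w F) S' := by
        intro x y w F hx hy hvx hvy hxy hw h
        have h1 := (h x y).of_addStar_of_notMem (by rcases hw with rfl | rfl <;> simp)
        refine hno {v, x, y} ?_ (S' \ {x, y}) ?_ ?_ (cyc_triangle hvx hvy hxy) h1
        · rw [← hS]; simp [insert_subset_iff, hx, hy]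
        · rw [← hS]; exact sdiff_subset.trans (subset_insert _ _)
        · rw [Finset.disjoint_left]
          intro u hu hu'
          simp only [mem_sdiff, mem_insert, mem_singleton] at hu hu'
          have : u ≠ v := fun e => hvS' (e ▸ hu'.1)
          tauto
      obtain h1 | h2 | h3 : degIn G v S ≤ 1 ∨ degIn G v S = 2 ∨ degIn G v S = 3 := by omega
      · refine reduce v ∅ (by simp) (by simp) (by simp) (by simp) (Or.inr (by simpa using h1))
          (by omega) (by simp) (Or.inl (by simpa using h1))
      · obtain ⟨x, y, hxy, hNv⟩ := card_eq_two.1 h2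
        have hx := hmemN x (by rw [hNv]; simp)
        have hy := hmemN y (by rw [hNv]; simp)
        by_cases hadj : G.Adj x y
        · refine reduce x ∅ (by simp) (by simp) (by simp) (by simp) (Or.inl ?_)
            (by omega) (by simp) (Or.inr (triangle x y x ∅ hx.1 hy.1 hx.2 hy.2 hadj (Or.inl rfl)))
          intro p hp q hq hvp hvq hpq
          rw [addStar_empty]
          have hp' : p ∈ S.filter (G.Adj v) := mem_filter.2 ⟨hS ▸ mem_insert_of_mem hp, hvp⟩
          have hq' : q ∈ S.filter (G.Adj v) := mem_filter.2 ⟨hS ▸ mem_insert_of_mem hq, hvq⟩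
          rw [hNv] at hp' hq'
          simp only [mem_insert, mem_singleton] at hp' hq'
          have := hadj.symm
          grind
        · refine reduce x {y} ?_ (by simpa using hy.1) (by simpa using hxy) (fun _ => hx)
            (Or.inr (by simp [h2])) (by simp [h2]) (by simp [h2]) (Or.inl (by simp [h2]))
          simpa using ⟨hy.2, hadj⟩
      · obtain ⟨x, y, z, hxy, hxz, hyz, hNv⟩ := card_eq_three.1 h3
        -- At least two of the three pairs of neighbours are non-adjacent: contract `v` into the
        -- neighbour they share, losing one edge.
        have contract : ∀ x y z : V, x ≠ y → x ≠ z → y ≠ z → S.filter (G.Adj v) = {x, y, z} →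
            ¬ G.Adj x y → ¬ G.Adj x z →
            (∃ a b c, IsTripleHit G S a b c) ∨ (NoPairHits G S ∧ edgesIn G S ≤ #S + 5) := by
          intro x y z hxy hxz hyz hNv nxy nxz
          have hx := hmemN x (by rw [hNv]; simp)
          have hy := hmemN y (by rw [hNv]; simp)
          have hz := hmemN z (by rw [hNv]; simp)
          have hcF : #({y, z} : Finset V) = 2 := card_pair hyz
          refine reduce x {y, z} ?_ (by simp [insert_subset_iff, hy.1, hz.1])
            (by simp [hxy, hxz]) (fun _ => hx)
            (Or.inr (by omega)) (by omega) (by omega) (Or.inl (by omega))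
          simp [hy.2, hz.2, nxy, nxz]
        -- Exactly one pair is non-adjacent: adding it makes the neighbours a clique, losing two
        -- edges.
        have join : ∀ x y z : V, x ≠ y → x ≠ z → y ≠ z → S.filter (G.Adj v) = {x, y, z} →
            ¬ G.Adj x y → G.Adj x z → G.Adj y z →
            (∃ a b c, IsTripleHit G S a b c) ∨ (NoPairHits G S ∧ edgesIn G S ≤ #S + 5) := by
          intro x y z hxy hxz hyz hNv nxy axz ayz
          have hx := hmemN x (by rw [hNv]; simp)
          have hy := hmemN y (by rw [hNv]; simp)
          have hz := hmemN z (by rw [hNv]; simp)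
          refine reduce x {y} ?_ (by simpa using hy.1) (by simpa using hxy) (fun _ => hx)
            (Or.inl ?_) (by simp [h3]) (by simp [h3])
            (Or.inr (triangle x z x {y} hx.1 hz.1 hx.2 hz.2 axz (Or.inl rfl)))
          · simpa using ⟨hy.2, nxy⟩
          · intro p hp q hq hvp hvq hpq
            have hp' : p ∈ S.filter (G.Adj v) := mem_filter.2 ⟨hS ▸ mem_insert_of_mem hp, hvp⟩
            have hq' : q ∈ S.filter (G.Adj v) := mem_filter.2 ⟨hS ▸ mem_insert_of_mem hq, hvq⟩
            rw [hNv] at hp' hq'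
            simp only [mem_insert, mem_singleton] at hp' hq'
            rw [addStar_adj]
            have := axz.symm
            have := ayz.symm
            simp only [mem_singleton]
            grind
        have e1 : ({x, y, z} : Finset V) = {y, x, z} := Finset.insert_comm _ _ _
        have e2 : ({x, y, z} : Finset V) = {z, x, y} := by ext; simp; tauto
        have e3 : ({x, y, z} : Finset V) = {x, z, y} := by rw [pair_comm]
        have e4 : ({x, y, z} : Finset V) = {y, z, x} := by ext; simp; tauto
        by_cases axy : G.Adj x y <;> by_cases axz : G.Adj x z <;> by_cases ayz : G.Adj y z
        · exact Or.inl ⟨x, y, z, isTripleHit_of_clique_neighbors hno hv hNv axy axz ayz⟩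
        · exact join y z x hyz hxy.symm hxz.symm (hNv.trans e4) ayz axy.symm axz.symm
        · exact join x z y hxz hxy hyz.symm (hNv.trans e3) axz axy ayz.symm
        · exact contract z x y hxz.symm hyz.symm hxy (hNv.trans e2) (fun h => axz h.symm)
            fun h => ayz h.symm
        · exact join x y z hxy hxz hyz hNv axy axz ayz
        · exact contract y x z hxy.symm hyz hxz (hNv.trans e1) (fun h => axy h.symm) ayz
        · exact contract x y z hxy hxz hyz hNv axy axz
        · exact contract x y z hxy hxz hyz hNv axy axz

end

/-! ### Saturation forces a triangle with a forest; leaf deletion -/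

section
open scoped Classical
variable {V : Type*}

/-- Two disjoint cycles would need four vertices of the triple. -/
theorem IsTripleHit.noTwoCycles {G : SimpleGraph V} {S : Finset V} {a b c : V}
    (h : IsTripleHit G S a b c) : NoTwoCycles G S := by
  have aux : ∀ A ⊆ S, Cyc G A → (a ∈ A ∨ b ∈ A) ∧ (a ∈ A ∨ c ∈ A) ∧ (b ∈ A ∨ c ∈ A) := by
    intro A hA hc
    have key : ∀ x y, ¬ Cyc G (S \ {x, y}) → x ∈ A ∨ y ∈ A := by
      intro x y hxy
      by_contra hcon
      push Not at hcon
      refine hxy (hc.subset fun z hz => ?_)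
      simp only [mem_sdiff, mem_insert, mem_singleton, not_or]
      exact ⟨hA hz, ne_of_mem_of_not_mem hz hcon.1, ne_of_mem_of_not_mem hz hcon.2⟩
    exact ⟨key _ _ h.not_cyc_ab, key _ _ h.not_cyc_ac, key _ _ h.not_cyc_bc⟩
  intro A hA B hB hAB hcA hcB
  have h1 := aux A hA hcA
  have h2 := aux B hB hcB
  rw [Finset.disjoint_left] at hAB
  have := @hAB a; have := @hAB b; have := @hAB c
  tauto

theorem noTwoCycles_univ_iff [Fintype V] {G : SimpleGraph V} :
    NoTwoCycles G univ ↔ ∀ p, ¬ (twoCycles p).IsContained G := by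
  constructor
  · rintro h ⟨⟨n, m⟩, hn, hm⟩ ⟨f⟩
    let f1 : Copy (cycleGraph n) G :=
      ⟨⟨fun i => f (Sum.inl i), fun {i j} hij => f.toHom.map_adj hij⟩,
        fun i j hij => Sum.inl_injective (f.injective hij)⟩
    let f2 : Copy (cycleGraph m) G :=
      ⟨⟨fun i => f (Sum.inr i), fun {i j} hij => f.toHom.map_adj hij⟩,
        fun i j hij => Sum.inr_injective (f.injective hij)⟩
    refine h (univ.image f1) (subset_univ _) (univ.image f2) (subset_univ _) ?_
      (cyc_iff_exists_copy.2 ⟨n, hn, f1, fun i => mem_image_of_mem _ (mem_univ _)⟩)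
      (cyc_iff_exists_copy.2 ⟨m, hm, f2, fun i => mem_image_of_mem _ (mem_univ _)⟩)
    rw [Finset.disjoint_left]
    intro x hx hx'
    obtain ⟨i, _, rfl⟩ := mem_image.1 hx
    obtain ⟨j, _, hj⟩ := mem_image.1 hx'
    exact absurd (f.injective hj) (by simp)
  · intro h A _ B _ hAB hA hB
    obtain ⟨n, hn, f, hf⟩ := cyc_iff_exists_copy.1 hA
    obtain ⟨m, hm, g, hg⟩ := cyc_iff_exists_copy.1 hB
    refine h ⟨(n, m), hn, hm⟩ ⟨⟨⟨Sum.elim f g, ?_⟩, ?_⟩⟩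
    · rintro (i | i) (j | j) hij
      · exact f.toHom.map_adj hij
      · exact absurd hij (by simp [twoCycles])
      · exact absurd hij (by simp [twoCycles])
      · exact g.toHom.map_adj hij
    · rw [Finset.disjoint_left] at hAB
      rintro (i | i) (j | j) hij
      · exact congrArg Sum.inl (f.injective hij)
      · exact absurd (hg j) (by simp only [RelHom.coeFn_mk, Sum.elim_inl, Sum.elim_inr] at hij; exact hij ▸ hAB (hf i))
      · exact absurd (hg i) (by simp only [RelHom.coeFn_mk, Sum.elim_inl, Sum.elim_inr] at hij; exact hij ▸ hAB (hf j))
      · exact congrArg Sum.inr (g.injective hij)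

theorem addStar_singleton_eq_sup_edge (G : SimpleGraph V) (u w : V) :
    addStar G u {w} = G ⊔ edge u w := by
  ext x y
  simp only [addStar_adj, sup_adj, edge_adj, mem_singleton]
  grind

theorem Cyc.of_addStar_singleton {G : SimpleGraph V} {C : Finset V} {u w : V}
    (h : Cyc (addStar G u {w}) C) (hC : u ∉ C ∨ w ∉ C) : Cyc G C := by
  refine h.mono le_rfl fun x hx y hy hxy => ?_
  simp only [addStar_adj, mem_singleton] at hxy
  grind

/-- A forest with so few edges is disconnected; joining `t` to a vertex of another component closes
no cycle. -/
theorem exists_not_cyc_addStar {G : SimpleGraph V} {A : Finset V} {t : V} (hA : ¬ Cyc G A)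
    (ht : t ∈ A) (hlt : edgesIn G A + 1 < #A) :
    ∃ w ∈ A, w ≠ t ∧ ¬ G.Adj t w ∧ ¬ Cyc (addStar G t {w}) A := by
  unfold Cyc at hA
  push Not at hA
  obtain ⟨t', ht'⟩ : ∃ t' : (A : Set V), t' = ⟨t, ht⟩ := ⟨_, rfl⟩
  have hnr : ∃ w, ¬ (G.induce (A : Set V)).Reachable t' w := by
    by_contra hcon
    push Not at hcon
    have hconn : (G.induce (A : Set V)).Connected :=
      (connected_iff_exists_forall_reachable _).2 ⟨t', hcon⟩
    have := hconn.card_vert_le_card_edgeSet_add_one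
    rw [Nat.card_coe_set_eq (G.induce (A : Set V)).edgeSet, ← edgesIn_eq_ncard_induce] at this
    have hA' : Nat.card (A : Set V) = #A := by simp
    omega
  obtain ⟨w, hw⟩ := hnr
  have hne : (w : V) ≠ t := by
    intro h
    have : w = t' := Subtype.ext (by rw [h, ht'])
    exact hw (this ▸ Reachable.rfl)
  refine ⟨w, w.2, hne, ?_, ?_⟩
  · intro h
    refine hw (Adj.reachable ?_)
    rw [ht']
    exact h
  · unfold Cyc
    push Not
    have h1 := (isAcyclic_add_edge_iff_of_not_reachable t' w hw).2 hA
    convert h1 using 1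
    ext x y
    simp only [comap_adj, Function.Embedding.subtype_apply, addStar_adj, sup_adj, edge_adj,
      mem_singleton, ht', Subtype.ext_iff, ne_eq]
    grind

/-- The counting conditions that characterize a triangle `B` together with trees, forming `A`, each
of which has exactly one edge to each vertex of `B`. -/
structure IsTriangleForest (G : SimpleGraph V) (A B : Finset V) (k : ℕ) : Prop where
  card_triangle : #B = 3
  clique : ∀ s ∈ B, ∀ t ∈ B, s ≠ t → G.Adj s t
  disjoint : Disjoint A B
  degIn_eq : ∀ t ∈ B, degIn G t A = k
  edgesIn_add : edgesIn G A + k = #A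
  not_cyc : ∀ t ∈ B, ¬ Cyc G (insert t A)

theorem isTriangleForest_of_isSaturated [Fintype V] {G : SimpleGraph V}
    (hsat : IsSaturated twoCycles G) {a b c : V} (h : IsTripleHit G univ a b c) :
    ∃ k, IsTriangleForest G (univ \ {a, b, c}) {a, b, c} k := by
  have hadd : ∀ u w, u ≠ w → ¬ G.Adj u w → ¬ IsTripleHit (addStar G u {w}) univ a b c := by
    intro u w huw hnadj hst
    obtain ⟨p, hp⟩ := hsat.2 u w huw hnadj
    rw [addStar_singleton_eq_sup_edge] at hst
    exact noTwoCycles_univ_iff.1 hst.noTwoCycles p hp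
  -- Removing two vertices of the triple destroys any edge inside it, so adding such an edge keeps
  -- the triple valid.
  have hadj : ∀ u w, u ∈ ({a, b, c} : Finset V) → w ∈ ({a, b, c} : Finset V) → u ≠ w →
      G.Adj u w := by
    intro u w hu hw huw
    by_contra hnadj
    simp only [mem_insert, mem_singleton] at hu hw
    have := h.hab; have := h.hac; have := h.hbc
    refine hadd u w huw hnadj ⟨h.hab, h.hac, h.hbc, mem_univ _, mem_univ _, mem_univ _,
      fun hc => h.not_cyc_ab (hc.of_addStar_singleton ?_),
      fun hc => h.not_cyc_ac (hc.of_addStar_singleton ?_),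
      fun hc => h.not_cyc_bc (hc.of_addStar_singleton ?_)⟩ <;>
      simp only [mem_sdiff, mem_univ, true_and, mem_insert, mem_singleton] <;> grind
  obtain ⟨U, hUdef⟩ : ∃ U, U = univ \ {a, b, c} := ⟨_, rfl⟩
  have hmemU : ∀ x, x ∈ U ↔ x ≠ a ∧ x ≠ b ∧ x ≠ c := by
    intro x; simp [hUdef]
  have ha : insert a U = univ \ {b, c} := by
    ext x
    simp only [mem_insert, hmemU, mem_sdiff, mem_univ, true_and, mem_singleton]
    have := h.hab; have := h.hac; grind
  have hb : insert b U = univ \ {a, c} := by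
    ext x
    simp only [mem_insert, hmemU, mem_sdiff, mem_univ, true_and, mem_singleton]
    have := h.hab; have := h.hbc; grind
  have hc : insert c U = univ \ {a, b} := by
    ext x
    simp only [mem_insert, hmemU, mem_sdiff, mem_univ, true_and, mem_singleton]
    have := h.hac; have := h.hbc; grind
  have hcount : ∀ t ∈ ({a, b, c} : Finset V), ¬ Cyc G (insert t U) ∧
      edgesIn G U + degIn G t U = #U := by
    intro t ht
    have htU : t ∉ U := by
      rw [hUdef]; exact fun h => (mem_sdiff.1 h).2 ht
    have hac : ¬ Cyc G (insert t U) := by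
      simp only [mem_insert, mem_singleton] at ht
      rcases ht with rfl | rfl | rfl
      · rw [ha]; exact h.not_cyc_bc
      · rw [hb]; exact h.not_cyc_ac
      · rw [hc]; exact h.not_cyc_ab
    refine ⟨hac, ?_⟩
    have h1 := edgesIn_lt_of_not_cyc hac (by simp)
    rw [edgesIn_insert G htU, card_insert_of_notMem htU] at h1
    by_contra hne
    -- If `U ∪ {t}` is not a tree, some edge `tw` can be added to it without a cycle. The other two
    -- conditions on the triple remove `t`, and with it this edge.
    obtain ⟨w, hw, hwt, hnadj, hnc⟩ := exists_not_cyc_addStar hac (mem_insert_self _ _)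
      (by rw [edgesIn_insert G htU, card_insert_of_notMem htU]; omega)
    refine hadd t w hwt.symm hnadj ?_
    simp only [mem_insert, mem_singleton] at ht
    have := h.hab; have := h.hac; have := h.hbc
    rcases ht with rfl | rfl | rfl
    · refine ⟨h.hab, h.hac, h.hbc, mem_univ _, mem_univ _, mem_univ _,
        fun hc => h.not_cyc_ab (hc.of_addStar_singleton (by simp)),
        fun hc => h.not_cyc_ac (hc.of_addStar_singleton (by simp)), ha ▸ hnc⟩
    · refine ⟨h.hab, h.hac, h.hbc, mem_univ _, mem_univ _, mem_univ _,
        fun hc => h.not_cyc_ab (hc.of_addStar_singleton (by simp)), hb ▸ hnc,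
        fun hc => h.not_cyc_bc (hc.of_addStar_singleton (by simp))⟩
    · refine ⟨h.hab, h.hac, h.hbc, mem_univ _, mem_univ _, mem_univ _, hc ▸ hnc,
        fun hc => h.not_cyc_ac (hc.of_addStar_singleton (by simp)),
        fun hc => h.not_cyc_bc (hc.of_addStar_singleton (by simp))⟩
  rw [← hUdef]
  refine ⟨degIn G a U, card_eq_three.2 ⟨a, b, c, h.hab, h.hac, h.hbc, rfl⟩,
    fun s hs t ht hst => hadj s t hs ht hst, ?_, ?_, (hcount a (by simp)).2,
    fun t ht => (hcount t ht).1⟩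
  · rw [hUdef]; exact sdiff_disjoint
  · intro t ht
    have h1 := (hcount t ht).2
    have h2 := (hcount a (by simp)).2
    omega

section
variable {G : SimpleGraph V} {A B : Finset V} {k : ℕ}

theorem IsTriangleForest.notMem (h : IsTriangleForest G A B k) {t : V} (ht : t ∈ B) : t ∉ A :=
  fun h' => Finset.disjoint_left.1 h.disjoint h' ht

theorem IsTriangleForest.degIn_eq_two (h : IsTriangleForest G A B k) {t : V} (ht : t ∈ B) :
    degIn G t B = 2 := by
  rw [← degIn_erase_self, degIn_eq_card.2, card_erase_of_mem ht, h.card_triangle]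
  exact fun x hx => h.clique t ht x (mem_of_mem_erase hx) (ne_of_mem_erase hx).symm

/-- `A ∪ {t}` is a tree; if `t` missed an isolated `v`, the rest would be acyclic with as many edges
as vertices. -/
theorem IsTriangleForest.adj_of_degIn_eq_zero (h : IsTriangleForest G A B k) {v t : V}
    (hv : v ∈ A) (hv0 : degIn G v A = 0) (ht : t ∈ B) : G.Adj t v := by
  by_contra hnadj
  have h1 := degIn_add_edgesIn_le (h.not_cyc t ht) (T := A.erase v) (a := t)
    (insert_subset_insert _ (erase_subset _ _)) (fun h' => h.notMem ht (mem_of_mem_erase h'))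
  have h2 := edgesIn_erase G hv
  have h3 := h.edgesIn_add
  have h4 := card_erase_add_one hv
  rw [degIn_erase_of_not_adj hnadj, h.degIn_eq t ht] at h1
  omega

theorem IsTriangleForest.edgesIn_union (h : IsTriangleForest G A B k) :
    edgesIn G (A ∪ B) = edgesIn G A + 3 * k + 3 := by
  obtain ⟨a, b, c, hab, hac, hbc, rfl⟩ := card_eq_three.1 h.card_triangle
  have ha := h.notMem (t := a) (by simp)
  have hb := h.notMem (t := b) (by simp)
  have hc := h.notMem (t := c) (by simp)
  have e : A ∪ {a, b, c} = insert a (insert b (insert c A)) := by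
    ext x; simp only [mem_union, mem_insert, mem_singleton]; tauto
  rw [e, edgesIn_insert G (by simp [hab, hac, ha]), edgesIn_insert G (by simp [hbc, hb]),
    edgesIn_insert G hc,
    degIn_insert_of_adj (by simp [hbc, hb]) (h.clique a (by simp) b (by simp) hab),
    degIn_insert_of_adj hc (h.clique a (by simp) c (by simp) hac),
    degIn_insert_of_adj hc (h.clique b (by simp) c (by simp) hbc),
    h.degIn_eq a (by simp), h.degIn_eq b (by simp), h.degIn_eq c (by simp)]
  ring

theorem IsTriangleForest.erase (h : IsTriangleForest G A B k) {v : V} (hv : v ∈ A)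
    (h1 : degIn G v A = 1) (hB : ∀ t ∈ B, ¬ G.Adj v t) :
    IsTriangleForest G (A.erase v) B k where
  card_triangle := h.card_triangle
  clique := h.clique
  disjoint := h.disjoint.mono_left (erase_subset _ _)
  degIn_eq t ht := by
    rw [degIn_erase_of_not_adj fun h' => hB t ht h'.symm, h.degIn_eq t ht]
  edgesIn_add := by
    have h2 := edgesIn_erase G hv
    have h3 := card_erase_add_one hv
    have h4 := h.edgesIn_add
    omega
  not_cyc t ht hc := h.not_cyc t ht (hc.subset (insert_subset_insert _ (erase_subset _ _)))

theorem ncard_neighborSet_inter (G : SimpleGraph V) (v : V) (A : Finset V) :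
    (G.neighborSet v ∩ A).ncard = degIn G v A := by
  unfold degIn
  rw [← Set.ncard_coe_finset]
  congr 1
  ext x
  simp [and_comm]

/-- Triangle vertices always have degree at least two, and a vertex of `A` isolated in `A` has three
neighbours in `B`. A vertex of degree one is therefore a leaf of one of the trees without an edge to
`B`, and its removal keeps `k`. -/
theorem IsTriangleForest.leafDeletion [Fintype V] (h : IsTriangleForest G A B k)
    (huniv : A ∪ B = univ) {S : Set V} (hS : LeafDeletion G S) :
    ∃ A', S = ((A' ∪ B : Finset V) : Set V) ∧ IsTriangleForest G A' B k := by
  induction hS with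
  | start => exact ⟨A, by rw [huniv]; simp, h⟩
  | delete S v _ hv h1 ih =>
    obtain ⟨A', rfl, hA'⟩ := ih
    rw [ncard_neighborSet_inter, degIn_union hA'.disjoint] at h1
    have hvB : v ∉ B := by
      intro hvB
      have := hA'.degIn_eq_two hvB
      omega
    have hvA : v ∈ A' := by
      have : v ∈ A' ∪ B := by exact_mod_cast hv
      exact (mem_union.1 this).resolve_right hvB
    have hdA : degIn G v A' ≠ 0 := by
      intro h0
      have : degIn G v B = #B :=
        degIn_eq_card.2 fun t ht => (hA'.adj_of_degIn_eq_zero hvA h0 ht).symm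
      have := hA'.card_triangle
      omega
    have hdB : ∀ t ∈ B, ¬ G.Adj v t := by
      intro t ht hadj
      have := degIn_pos.2 ⟨t, ht, hadj⟩
      omega
    refine ⟨A'.erase v, ?_, hA'.erase hvA (by omega) hdB⟩
    rw [← erase_eq_of_notMem hvB, ← erase_union_distrib, coe_erase, erase_eq_of_notMem hvB]

theorem exists_isLeaflessCore [Fintype V] (G : SimpleGraph V) : ∃ S, IsLeaflessCore G S := by
  have key : ∀ n, ∀ S : Set V, S.ncard = n → LeafDeletion G S → ∃ S, IsLeaflessCore G S := by
    intro n
    induction n using Nat.strong_induction_on with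
    | _ n ih =>
      intro S hn hS
      by_cases hleaf : ∀ v ∈ S, (G.neighborSet v ∩ S).ncard ≠ 1
      · exact ⟨S, hS, hleaf⟩
      · push Not at hleaf
        obtain ⟨v, hv, h1⟩ := hleaf
        exact ih _ (hn ▸ Set.ncard_sdiff_singleton_lt_of_mem hv) _ rfl (.delete S v hS hv h1)
  exact key _ _ rfl .start

theorem edgesIn_univ [Fintype V] (G : SimpleGraph V) : edgesIn G univ = G.edgeSet.ncard := by
  unfold edgesIn
  rw [← Set.ncard_coe_finset]
  congr 1
  ext e
  simp

end
end

/-! ### Constructing subdivisions -/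

section
open scoped Classical

/-- In the definition of a subdivision it suffices that the two paths of an edge have the same
vertices and edges. -/
theorem isSubdivision_of_reverse_mem {V W : Type*} [LinearOrder W] {H : SimpleGraph V}
    {G : SimpleGraph W} (f : W → V) (P : ∀ a b : W, G.Adj a b → H.Walk (f a) (f b))
    (hf : Function.Injective f) (hP : ∀ a b (h : G.Adj a b), (P a b h).IsPath)
    (hs : ∀ a b (h : G.Adj a b), ∀ x ∈ (P a b h).support, x ∈ (P b a h.symm).support)
    (he : ∀ a b (h : G.Adj a b), ∀ e ∈ (P a b h).edges, e ∈ (P b a h.symm).edges)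
    (hb : ∀ a b (h : G.Adj a b) (c : W), f c ∈ (P a b h).support → c = a ∨ c = b)
    (hm : ∀ a b (h : G.Adj a b) c d (h' : G.Adj c d), s(a, b) ≠ s(c, d) →
      ∀ x, x ∈ (P a b h).support → x ∈ (P c d h').support → x ∈ Set.range f)
    (hV : ∀ x : V, x ∈ Set.range f ∨ ∃ a b, ∃ h : G.Adj a b, x ∈ (P a b h).support)
    (hE : ∀ e ∈ H.edgeSet, ∃ a b, ∃ h : G.Adj a b, e ∈ (P a b h).edges) : IsSubdivision H G := by
  -- The order on `W` selects one orientation of each edge; the other one receives the reversed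
  -- walk.
  obtain ⟨Q, hQ⟩ : ∃ Q : ∀ a b : W, G.Adj a b → H.Walk (f a) (f b),
      ∀ a b h, Q a b h = if a < b then P a b h else (P b a h.symm).reverse := ⟨_, fun _ _ _ => rfl⟩
  have hsup : ∀ a b h x, x ∈ (Q a b h).support ↔ x ∈ (P a b h).support := by
    intro a b h x
    rw [hQ]
    split_ifs
    · rfl
    · rw [Walk.support_reverse, List.mem_reverse]
      exact ⟨hs b a h.symm x, hs a b h x⟩
  have hedg : ∀ a b h e, e ∈ (Q a b h).edges ↔ e ∈ (P a b h).edges := by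
    intro a b h e
    rw [hQ]
    split_ifs
    · rfl
    · rw [Walk.edges_reverse, List.mem_reverse]
      exact ⟨he b a h.symm e, he a b h e⟩
  refine ⟨f, Q, hf, ?_, ?_, ?_, ?_, ?_, ?_⟩
  · intro a b h
    rw [hQ]
    split_ifs
    · exact hP a b h
    · exact (hP b a h.symm).reverse
  · intro a b h
    rw [hQ, hQ]
    rcases lt_or_gt_of_ne h.ne with hlt | hlt
    · rw [if_neg hlt.not_gt, if_pos hlt]
    · rw [if_pos hlt, if_neg hlt.not_gt, Walk.reverse_reverse]
  · intro a b h c hc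
    exact hb a b h c ((hsup _ _ _ _).1 hc)
  · intro a b h c d h' hne x hx hx'
    exact hm a b h c d h' hne x ((hsup _ _ _ _).1 hx) ((hsup _ _ _ _).1 hx')
  · intro x
    refine (hV x).imp id ?_
    rintro ⟨a, b, h, hx⟩
    exact ⟨a, b, h, (hsup _ _ _ _).2 hx⟩
  · intro e hee
    obtain ⟨a, b, h, hx⟩ := hE e hee
    exact ⟨a, b, h, (hedg _ _ _ _).2 hx⟩

theorem isSubdivision_of_bijective {V W : Type*} {H : SimpleGraph V} {G : SimpleGraph W}
    (f : W → V) (hf : Function.Bijective f) (hadj : ∀ a b, H.Adj (f a) (f b) ↔ G.Adj a b) :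
    IsSubdivision H G := by
  refine ⟨f, fun a b h => ((hadj a b).2 h).toWalk, hf.1, ?_, ?_, ?_, ?_, ?_, ?_⟩
  · intro a b h
    simp [Walk.cons_isPath_iff, hf.1.eq_iff, h.ne]
  · intro a b h
    simp
  · intro a b h c hc
    simpa [hf.1.eq_iff] using hc
  · intro a b h c d h' _ x _ _
    exact hf.2 x
  · exact fun x => Or.inl (hf.2 x)
  · intro e he
    induction e with | _ x y
    obtain ⟨a, rfl⟩ := hf.2 x
    obtain ⟨b, rfl⟩ := hf.2 y
    exact ⟨a, b, (hadj a b).1 he, by simp⟩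

section
variable {V V' : Type*} {H : SimpleGraph V} {H' : SimpleGraph V'} {ι : V' → V} {u : V} {x y : V'}

/-- Every passage through `xy` is replaced by a detour through `u`. A path makes at most one such
passage, so it remains a path. -/
theorem exists_walk_subdividing (hι : Function.Injective ι) (hu : ∀ z, ι z ≠ u)
    (hxu : H.Adj (ι x) u) (huy : H.Adj u (ι y))
    (hmap : ∀ p q, H'.Adj p q → s(p, q) ≠ s(x, y) → H.Adj (ι p) (ι q)) {p q : V'}
    (w : H'.Walk p q) : ∃ w' : H.Walk (ι p) (ι q),
      (∀ z, z ∈ w'.support ↔ (∃ z' ∈ w.support, ι z' = z) ∨ (z = u ∧ s(x, y) ∈ w.edges)) ∧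
      (∀ e, e ∈ w'.edges ↔ (∃ e' ∈ w.edges, e' ≠ s(x, y) ∧ e'.map ι = e) ∨
        (s(x, y) ∈ w.edges ∧ (e = s(ι x, u) ∨ e = s(u, ι y)))) ∧
      (w.IsPath → w'.IsPath) := by
  induction w with
  | nil => exact ⟨Walk.nil, by simp [eq_comm], by simp, by simp⟩
  | @cons p r q h w ih =>
    obtain ⟨w', hs, he, hp⟩ := ih
    have key : ∀ (h1 : H.Adj (ι p) u) (h2 : H.Adj u (ι r)), s(p, r) = s(x, y) →
        (∀ e, e = s(ι p, u) ∨ e = s(u, ι r) ↔ e = s(ι x, u) ∨ e = s(u, ι y)) →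
        ∃ w' : H.Walk (ι p) (ι q),
      (∀ z, z ∈ w'.support ↔ (∃ z' ∈ (Walk.cons h w).support, ι z' = z) ∨
        (z = u ∧ s(x, y) ∈ (Walk.cons h w).edges)) ∧
      (∀ e, e ∈ w'.edges ↔ (∃ e' ∈ (Walk.cons h w).edges, e' ≠ s(x, y) ∧ e'.map ι = e) ∨
        (s(x, y) ∈ (Walk.cons h w).edges ∧ (e = s(ι x, u) ∨ e = s(u, ι y)))) ∧
      ((Walk.cons h w).IsPath → w'.IsPath) := by
      intro h1 h2 hpr hends
      refine ⟨Walk.cons h1 (Walk.cons h2 w'), ?_, ?_, ?_⟩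
      · intro z
        simp only [Walk.support_cons, List.mem_cons, hs, Walk.edges_cons, hpr, true_or, and_true]
        grind
      · intro e
        simp only [Walk.edges_cons, List.mem_cons, he, hpr, true_or, true_and]
        rw [← hends]
        grind
      · intro hpath
        rw [Walk.cons_isPath_iff] at hpath
        rw [Walk.cons_isPath_iff, Walk.cons_isPath_iff]
        have hpw : s(x, y) ∉ w.edges := fun h => hpath.2 (Walk.fst_mem_support_of_mem_edges w (hpr ▸ h))
        refine ⟨⟨hp hpath.1, ?_⟩, ?_⟩
        · rw [hs]
          rintro (⟨z, _, hz⟩ | ⟨_, h⟩)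
          · exact hu z hz
          · exact hpw h
        · rw [Walk.support_cons, List.mem_cons, hs]
          rintro (h | ⟨z, hz, hzp⟩ | ⟨h, _⟩)
          · exact hu p h
          · exact hpath.2 (hι hzp ▸ hz)
          · exact hu p h
    by_cases hpr : s(p, r) = s(x, y)
    · rcases Sym2.eq_iff.1 hpr with ⟨rfl, rfl⟩ | ⟨rfl, rfl⟩
      · exact key hxu huy hpr fun e => Iff.rfl
      · refine key huy.symm hxu.symm hpr fun e => ?_
        rw [Sym2.eq_swap (a := ι p), Sym2.eq_swap (a := ι r)]
        exact or_comm
    · refine ⟨Walk.cons (hmap p r h hpr) w', ?_, ?_, ?_⟩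
      · intro z
        simp only [Walk.support_cons, List.mem_cons, hs, Walk.edges_cons, Ne.symm hpr, false_or]
        grind
      · intro e
        simp only [Walk.edges_cons, List.mem_cons, he, Ne.symm hpr, false_or]
        constructor
        · rintro (rfl | ⟨e', h1, h2⟩ | h)
          · exact Or.inl ⟨s(p, r), Or.inl rfl, hpr, rfl⟩
          · exact Or.inl ⟨e', Or.inr h1, h2⟩
          · exact Or.inr h
        · rintro (⟨e', rfl | h1, h2⟩ | h)
          · exact Or.inl h2.2.symm
          · exact Or.inr (Or.inl ⟨e', h1, h2⟩)
          · exact Or.inr (Or.inr h)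
      · intro hpath
        rw [Walk.cons_isPath_iff] at hpath ⊢
        refine ⟨hp hpath.1, ?_⟩
        rw [hs]
        rintro (⟨z, hz, hzp⟩ | ⟨h, _⟩)
        · exact hpath.2 (hι hzp ▸ hz)
        · exact hu p h

/-- Subdividing the edge `xy` of `H'` by the new vertex `u` gives `H`. -/
theorem IsSubdivision.subdivide_edge {W : Type*} [LinearOrder W] {M : SimpleGraph W}
    (hM : IsSubdivision H' M) (hι : Function.Injective ι) (hu : ∀ z, ι z ≠ u)
    (hsurj : ∀ z, z = u ∨ ∃ z', ι z' = z) (hxy : H'.Adj x y)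
    (hadj : ∀ p q, H.Adj (ι p) (ι q) ↔ H'.Adj p q ∧ s(p, q) ≠ s(x, y))
    (hadju : ∀ p, H.Adj u (ι p) ↔ p = x ∨ p = y) : IsSubdivision H M := by
  obtain ⟨f, P, hf, hpath, hrev, hb, hm, hV, hE⟩ := hM
  have hw := fun a b (h : M.Adj a b) => exists_walk_subdividing (H := H) hι hu
    ((hadju x).2 (Or.inl rfl)).symm ((hadju y).2 (Or.inr rfl))
    (fun p q h h' => (hadj p q).2 ⟨h, h'⟩) (P a b h)
  choose Q hs he hp using hw
  refine isSubdivision_of_reverse_mem (ι ∘ f) Q (hι.comp hf) (fun a b h => hp a b h (hpath a b h))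
    ?_ ?_ ?_ ?_ ?_ ?_
  · intro a b h z hz
    rw [hs] at hz ⊢
    rw [hrev a b h]
    simpa using hz
  · intro a b h e hz
    rw [he] at hz ⊢
    rw [hrev a b h]
    simpa using hz
  · intro a b h c hc
    rw [hs] at hc
    rcases hc with ⟨z, hz, hzc⟩ | ⟨hc, _⟩
    · exact hb a b h c (hι hzc ▸ hz)
    · exact absurd hc (hu _)
  · intro a b h c d h' hne z hz hz'
    rw [hs] at hz hz'
    rcases hz with ⟨z1, hz1, rfl⟩ | ⟨rfl, hz1⟩
    · rcases hz' with ⟨z2, hz2, h12⟩ | ⟨h2, _⟩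
      · obtain ⟨t, ht⟩ := hm a b h c d h' hne z1 hz1 (hι h12 ▸ hz2)
        exact ⟨t, congrArg ι ht⟩
      · exact absurd h2 (hu _)
    · rcases hz' with ⟨z2, hz2, h12⟩ | ⟨_, hz2⟩
      · exact absurd h12 (hu _)
      -- Two paths sharing `u` both contained the edge `xy`. Then `x` and `y` are branch vertices
      -- and the ends of both paths, so the two edges of `M` coincide.
      · exfalso
        have hx1 := Walk.fst_mem_support_of_mem_edges _ hz1
        have hx2 := Walk.fst_mem_support_of_mem_edges _ hz2
        have hy1 := Walk.snd_mem_support_of_mem_edges _ hz1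
        have hy2 := Walk.snd_mem_support_of_mem_edges _ hz2
        obtain ⟨i, rfl⟩ := hm a b h c d h' hne x hx1 hx2
        obtain ⟨j, rfl⟩ := hm a b h c d h' hne y hy1 hy2
        have hij : i ≠ j := fun e => hxy.ne (congrArg f e)
        have := hb _ _ _ _ hx1
        have := hb _ _ _ _ hx2
        have := hb _ _ _ _ hy1
        have := hb _ _ _ _ hy2
        rw [ne_eq, Sym2.eq_iff] at hne
        grind
  · intro z
    rcases hsurj z with rfl | ⟨z', rfl⟩
    · right
      obtain ⟨a, b, h, hab⟩ := hE s(x, y) hxy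
      exact ⟨a, b, h, (hs a b h _).2 (Or.inr ⟨rfl, hab⟩)⟩
    · rcases hV z' with ⟨t, rfl⟩ | ⟨a, b, h, hab⟩
      · exact Or.inl ⟨t, rfl⟩
      · exact Or.inr ⟨a, b, h, (hs a b h _).2 (Or.inl ⟨z', hab, rfl⟩)⟩
  · have huw : ∀ w, H.Adj u w → ∃ a b, ∃ h : M.Adj a b, s(u, w) ∈ (Q a b h).edges := by
      intro w hw
      obtain ⟨a, b, h, hab⟩ := hE s(x, y) hxy
      refine ⟨a, b, h, (he a b h _).2 (Or.inr ⟨hab, ?_⟩)⟩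
      rcases hsurj w with rfl | ⟨w', rfl⟩
      · exact absurd rfl hw.ne
      · rcases (hadju w').1 hw with rfl | rfl
        · exact Or.inl Sym2.eq_swap
        · exact Or.inr rfl
    intro e hee
    induction e with | _ p q
    rcases hsurj p with rfl | ⟨p', rfl⟩
    · exact huw q hee
    rcases hsurj q with rfl | ⟨q', rfl⟩
    · obtain ⟨a, b, h, hab⟩ := huw _ (SimpleGraph.Adj.symm hee)
      exact ⟨a, b, h, Sym2.eq_swap ▸ hab⟩
    · have h1 := (hadj p' q').1 hee
      obtain ⟨a, b, h, hab⟩ := hE s(p', q') h1.1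
      exact ⟨a, b, h, (he a b h _).2 (Or.inl ⟨s(p', q'), hab, h1.2, rfl⟩)⟩

end
end

/-! ### Suppressing vertices of degree two down to the split graph -/

section
open scoped Classical
variable {V : Type*} {G : SimpleGraph V} {A B : Finset V} {k : ℕ}

theorem addStar_comm (G : SimpleGraph V) (x y : V) : addStar G x {y} = addStar G y {x} := by
  ext u w
  simp only [addStar_adj, mem_singleton]
  tauto

theorem IsTriangleForest.sum_degIn_union (h : IsTriangleForest G A B k) :
    ∑ v ∈ A, degIn G v (A ∪ B) = 2 * edgesIn G A + 3 * k := by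
  obtain ⟨a, b, c, hab, hac, hbc, rfl⟩ := card_eq_three.1 h.card_triangle
  have ha := h.notMem (t := a) (by simp)
  have hb := h.notMem (t := b) (by simp)
  have hc := h.notMem (t := c) (by simp)
  have e : A ∪ {a, b, c} = insert a (insert b (insert c A)) := by
    ext x; simp only [mem_union, mem_insert, mem_singleton]; tauto
  rw [e, sum_degIn_insert G (by simp [hab, hac, ha]), sum_degIn_insert G (by simp [hbc, hb]),
    sum_degIn_insert G hc, sum_degIn, h.degIn_eq a (by simp), h.degIn_eq b (by simp),
    h.degIn_eq c (by simp)]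
  ring

theorem IsTriangleForest.isSubdivision_of_edgesIn_eq_zero (h : IsTriangleForest G A B k)
    (h0 : edgesIn G A = 0) :
    IsSubdivision (G.induce ((A ∪ B : Finset V) : Set V)) (splitGraph (k + 3) 3) := by
  have hA : #A = k := by have := h.edgesIn_add; omega
  let eA := A.equivFinOfCardEq hA
  let eB := B.equivFinOfCardEq h.card_triangle
  have hd0 : ∀ v ∈ A, degIn G v A = 0 := by
    intro v hv
    have := edgesIn_erase G hv
    omega
  have hAA : ∀ v ∈ A, ∀ w ∈ A, ¬ G.Adj v w := by
    intro v hv w hw hvw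
    have := degIn_pos.2 ⟨w, hw, hvw⟩
    have := hd0 v hv
    omega
  obtain ⟨f, hfB, hfA⟩ : ∃ f : Fin (k + 3) → V, (∀ (i : Fin (k + 3)) (hi : (i : ℕ) < 3), f i = eB.symm ⟨i, hi⟩) ∧
      ∀ (i : Fin (k + 3)) (hi : ¬ (i : ℕ) < 3), f i = eA.symm ⟨i - 3, by omega⟩ :=
    ⟨fun i => if hi : (i : ℕ) < 3 then eB.symm ⟨i, hi⟩ else eA.symm ⟨i - 3, by omega⟩,
      fun i hi => dif_pos hi, fun i hi => dif_neg hi⟩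
  have hmB : ∀ i : Fin (k + 3), (i : ℕ) < 3 → f i ∈ B := fun i hi => by
    rw [hfB i hi]; exact (eB.symm _).2
  have hmA : ∀ i : Fin (k + 3), ¬ (i : ℕ) < 3 → f i ∈ A := fun i hi => by
    rw [hfA i hi]; exact (eA.symm _).2
  have hinj : Function.Injective f := by
    intro i j hij
    by_cases hi : (i : ℕ) < 3 <;> by_cases hj : (j : ℕ) < 3
    · rw [hfB i hi, hfB j hj] at hij
      have := eB.symm.injective (Subtype.ext hij)
      exact Fin.ext (by simpa using this)
    · exact absurd (hmB i hi) fun hB => h.notMem hB (hij ▸ hmA j hj)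
    · exact absurd (hmB j hj) fun hB => h.notMem hB (hij ▸ hmA i hi)
    · rw [hfA i hi, hfA j hj] at hij
      have := eA.symm.injective (Subtype.ext hij)
      simp only [Fin.mk.injEq] at this
      exact Fin.ext (by omega)
  refine isSubdivision_of_bijective (fun i => ⟨f i, ?_⟩) ⟨?_, ?_⟩ ?_
  · by_cases hi : (i : ℕ) < 3
    · simp [hmB i hi]
    · simp [hmA i hi]
  · exact fun i j hij => hinj (congrArg Subtype.val hij)
  · rintro ⟨v, hv⟩
    rcases mem_union.1 (mem_coe.1 hv) with hv | hv
    · obtain ⟨i, hi⟩ : ∃ i, i = eA ⟨v, hv⟩ := ⟨_, rfl⟩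
      refine ⟨⟨i + 3, by omega⟩, Subtype.ext ?_⟩
      exact (hfA ⟨i + 3, by omega⟩ (by simp)).trans (by simp [hi])
    · obtain ⟨i, hi⟩ : ∃ i, i = eB ⟨v, hv⟩ := ⟨_, rfl⟩
      refine ⟨⟨i, by omega⟩, Subtype.ext ?_⟩
      exact (hfB ⟨i, by omega⟩ (by simp)).trans (by simp [hi])
  · intro i j
    change G.Adj (f i) (f j) ↔ i ≠ j ∧ ((i : ℕ) < 3 ∨ (j : ℕ) < 3)
    constructor
    · intro hij
      refine ⟨fun e => hij.ne (congrArg f e), ?_⟩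
      by_contra hcon
      push Not at hcon
      exact hAA _ (hmA i (by omega)) _ (hmA j (by omega)) hij
    · rintro ⟨hne, hij⟩
      by_cases hi : (i : ℕ) < 3
      · by_cases hj : (j : ℕ) < 3
        · exact h.clique _ (hmB i hi) _ (hmB j hj) fun e => hne (hinj e)
        · exact h.adj_of_degIn_eq_zero (hmA j hj) (hd0 _ (hmA j hj)) (hmB i hi)
      · exact (h.adj_of_degIn_eq_zero (hmA i hi) (hd0 _ (hmA i hi))
          (hmB j (hij.resolve_left hi))).symm

/-- The degrees over `A` sum to `3 * #A - edgesIn G A`, so their average is below three. A vertex of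
degree two has a neighbour in `A`, since otherwise all of `B` would be adjacent to it. -/
theorem IsTriangleForest.exists_degIn_eq_two (h : IsTriangleForest G A B k)
    (h0 : edgesIn G A ≠ 0) (h2 : ∀ v ∈ A, 2 ≤ degIn G v (A ∪ B)) :
    ∃ u ∈ A, ∃ x ∈ A, ∃ y ∈ A ∪ B, x ≠ y ∧ (A ∪ B).filter (G.Adj u) = {x, y} := by
  have hu : ∃ u ∈ A, degIn G u (A ∪ B) = 2 := by
    by_contra hcon
    push Not at hcon
    have h3 : ∀ v ∈ A, 3 ≤ degIn G v (A ∪ B) := fun v hv =>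
      lt_of_le_of_ne (h2 v hv) (hcon v hv).symm
    have := sum_le_sum h3
    rw [h.sum_degIn_union, sum_const, smul_eq_mul] at this
    have := h.edgesIn_add
    omega
  obtain ⟨u, hu, hdu⟩ := hu
  have hduA : 0 < degIn G u A := by
    rw [Nat.pos_iff_ne_zero]
    intro h0
    have h1 : degIn G u B = #B :=
      degIn_eq_card.2 fun t ht => (h.adj_of_degIn_eq_zero hu h0 ht).symm
    rw [degIn_union h.disjoint, h1, h.card_triangle] at hdu
    omega
  obtain ⟨x, hx, hux⟩ := degIn_pos.1 hduA
  obtain ⟨p, q, hpq, hN⟩ := card_eq_two.1 hdu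
  have hxN : x ∈ (A ∪ B).filter (G.Adj u) := mem_filter.2 ⟨mem_union_left _ hx, hux⟩
  have hpN : p ∈ (A ∪ B).filter (G.Adj u) := by rw [hN]; simp
  have hqN : q ∈ (A ∪ B).filter (G.Adj u) := by rw [hN]; simp
  rw [hN] at hxN
  rcases mem_insert.1 hxN with rfl | hxN
  · exact ⟨u, hu, x, hx, q, (mem_filter.1 hqN).1, hpq, hN⟩
  · rw [mem_singleton] at hxN
    subst hxN
    exact ⟨u, hu, x, hx, p, (mem_filter.1 hpN).1, hpq.symm, hN.trans (pair_comm _ _)⟩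

section
variable {u x y : V}

theorem IsTriangleForest.not_adj_of_filter_eq (h : IsTriangleForest G A B k) (hu : u ∈ A)
    (hx : x ∈ A) (hy : y ∈ A ∪ B) (hux : G.Adj u x) (huy : G.Adj u y) : ¬ G.Adj x y := by
  intro hxy
  have hc := cyc_triangle hux huy hxy
  rcases mem_union.1 hy with hy | hy
  · obtain ⟨t, ht⟩ : B.Nonempty := card_pos.1 (by have := h.card_triangle; omega)
    refine h.not_cyc t ht (hc.subset ?_)
    simp [insert_subset_iff, hu, hx, hy]
  · refine h.not_cyc y hy (hc.subset ?_)
    simp [insert_subset_iff, hu, hx]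

/-- Suppressing a vertex `u` of degree two preserves the triangle-forest structure. -/
theorem IsTriangleForest.suppress (h : IsTriangleForest G A B k) (hu : u ∈ A)
    (hx : x ∈ A) (hy : y ∈ A ∪ B) (hxy : x ≠ y) (hN : (A ∪ B).filter (G.Adj u) = {x, y}) :
    IsTriangleForest (addStar G x {y}) (A.erase u) B k := by
  have hmem : ∀ z ∈ A ∪ B, G.Adj u z ↔ z = x ∨ z = y := by
    intro z hz
    have : z ∈ (A ∪ B).filter (G.Adj u) ↔ z ∈ ({x, y} : Finset V) := by rw [hN]
    rw [mem_filter, mem_insert, mem_singleton] at this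
    tauto
  have hux : G.Adj u x := (hmem x (mem_union_left _ hx)).2 (Or.inl rfl)
  have huy : G.Adj u y := (hmem y hy).2 (Or.inr rfl)
  have hnxy := h.not_adj_of_filter_eq hu hx hy hux huy
  have hx' : x ∈ A.erase u := mem_erase.2 ⟨hux.ne', hx⟩
  refine ⟨h.card_triangle, fun s hs t ht hst => le_addStar _ _ _ (h.clique s hs t ht hst),
    h.disjoint.mono_left (erase_subset _ _), ?_, ?_, ?_⟩
  · intro t ht
    have hxt : t ≠ x := fun e => h.notMem ht (e ▸ hx)
    by_cases hty : t = y
    · subst hty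
      rw [addStar_comm, degIn_addStar (by simpa using hx') (by simpa using hxt)
        (by simpa using fun h' => hnxy h'.symm), card_singleton, degIn_erase_of_adj hu huy.symm,
        h.degIn_eq t ht]
    · rw [← h.degIn_eq t ht, ← degIn_erase_of_not_adj (G := G) (v := u)]
      · refine degIn_congr fun z _ => ?_
        simp only [addStar_adj, mem_singleton]
        tauto
      · intro h'
        have := (hmem t (mem_union_right _ ht)).1 h'.symm
        tauto
  · have h1 := edgesIn_erase G hu
    have h2 := card_erase_add_one hu
    have h3 := h.edgesIn_add
    have h4 : degIn G u A + degIn G u B = 2 := by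
      rw [← degIn_union h.disjoint]
      exact (congrArg card hN).trans (card_pair hxy)
    have h5 : 0 < degIn G u A := degIn_pos.2 ⟨x, hx, hux⟩
    -- If `y ∈ A`, two forest edges at `u` become one; if `y ∈ B`, the only forest edge at `u`
    -- disappears and its edge to `y` moves to `x`. Either way the forest loses one vertex and one
    -- edge.
    rcases mem_union.1 hy with hyA | hyB
    · have h6 : degIn G u B = 0 := by
        by_contra h6
        obtain ⟨t, ht, hut⟩ := degIn_pos.1 (Nat.pos_of_ne_zero h6)
        rcases (hmem t (mem_union_right _ ht)).1 hut with rfl | rfl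
        · exact h.notMem ht hx
        · exact h.notMem ht hyA
      have h7 := edgesIn_addStar (G := G) (F := {y}) hx'
        (by simpa using ⟨huy.ne', hyA⟩) (by simpa using hxy) (by simpa using hnxy)
      rw [card_singleton] at h7
      omega
    · have h6 : 0 < degIn G u B := degIn_pos.2 ⟨y, hyB, huy⟩
      have h7 : edgesIn (addStar G x {y}) (A.erase u) = edgesIn G (A.erase u) := by
        refine edgesIn_congr fun p hp q hq => ?_
        have hpy : p ≠ y := fun e => h.notMem hyB (e ▸ mem_of_mem_erase hp)
        have hqy : q ≠ y := fun e => h.notMem hyB (e ▸ mem_of_mem_erase hq)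
        simp [addStar_adj, hpy, hqy]
      omega
  · intro t ht hc
    have hut : u ∉ insert t (A.erase u) := by
      rw [mem_insert, not_or]
      exact ⟨fun e => h.notMem ht (e ▸ hu), by simp⟩
    rcases hc.of_addStar hut (by simpa using huy) hux with h1 | ⟨_, h1⟩
    · exact h.not_cyc t ht (h1.subset (insert_subset_insert _ (erase_subset _ _)))
    · refine h.not_cyc t ht (h1.subset ?_)
      rw [Finset.insert_comm, insert_erase hu]

theorem two_le_degIn_suppress {S : Finset V} (hS : ∀ v ∈ S, v ≠ u → 2 ≤ degIn G v S)
    (hu : u ∈ S) (hx : x ∈ S) (hy : y ∈ S) (hxy : x ≠ y) (hnxy : ¬ G.Adj x y)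
    (hN : S.filter (G.Adj u) = {x, y}) {v : V} (hv : v ∈ S.erase u) :
    2 ≤ degIn (addStar G x {y}) v (S.erase u) := by
  have hmem : ∀ z ∈ S, G.Adj u z ↔ z = x ∨ z = y := by
    intro z hz
    have : z ∈ S.filter (G.Adj u) ↔ z ∈ ({x, y} : Finset V) := by rw [hN]
    rw [mem_filter, mem_insert, mem_singleton] at this
    tauto
  have hux := (hmem x hx).2 (Or.inl rfl)
  have huy := (hmem y hy).2 (Or.inr rfl)
  have hv' := mem_erase.1 hv
  have h2 := hS v hv'.2 hv'.1
  have aux : ∀ p q, p ≠ q → p ∈ S → q ∈ S → G.Adj u p → G.Adj u q → ¬ G.Adj p q → v = p →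
      2 ≤ degIn (addStar G p {q}) v (S.erase u) := by
    intro p q hpq hp hq hup huq hnpq hvp
    rw [hvp] at h2 ⊢
    rw [degIn_addStar (by simpa using ⟨huq.ne', hq⟩) (by simpa using hpq) (by simpa using hnpq),
      card_singleton, degIn_erase_of_adj hu hup.symm]
    exact h2
  by_cases hvx : v = x
  · exact aux x y hxy hx hy hux huy hnxy hvx
  by_cases hvy : v = y
  · rw [addStar_comm]
    exact aux y x hxy.symm hy hx huy hux (fun h => hnxy h.symm) hvy
  · have hnu : ¬ G.Adj v u := fun h => by
      have := (hmem v hv'.2).1 h.symm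
      tauto
    rw [← degIn_erase_of_not_adj hnu] at h2
    exact h2.trans (degIn_mono le_rfl fun _ _ h => le_addStar _ _ _ h)

theorem IsSubdivision.of_suppress {W : Type*} [LinearOrder W] {M : SimpleGraph W} {S : Finset V}
    (hu : u ∈ S) (hx : x ∈ S) (hy : y ∈ S) (hxy : x ≠ y) (hnxy : ¬ G.Adj x y)
    (hN : S.filter (G.Adj u) = {x, y})
    (h : IsSubdivision ((addStar G x {y}).induce (S.erase u : Set V)) M) :
    IsSubdivision (G.induce (S : Set V)) M := by
  have hmem : ∀ z ∈ S, G.Adj u z ↔ z = x ∨ z = y := by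
    intro z hz
    have : z ∈ S.filter (G.Adj u) ↔ z ∈ ({x, y} : Finset V) := by rw [hN]
    rw [mem_filter, mem_insert, mem_singleton] at this
    tauto
  have hux := (hmem x hx).2 (Or.inl rfl)
  have huy := (hmem y hy).2 (Or.inr rfl)
  have hxe : x ∈ S.erase u := mem_erase.2 ⟨hux.ne', hx⟩
  have hye : y ∈ S.erase u := mem_erase.2 ⟨huy.ne', hy⟩
  refine h.subdivide_edge (ι := fun z => ⟨z.1, mem_coe.2 (mem_of_mem_erase (mem_coe.1 z.2))⟩)
    (u := ⟨u, hu⟩) (x := ⟨x, hxe⟩) (y := ⟨y, hye⟩) ?_ ?_ ?_ ?_ ?_ ?_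
  · exact fun p q hpq => Subtype.ext (Subtype.mk.inj hpq)
  · exact fun z hz => ne_of_mem_erase (mem_coe.1 z.2) (congrArg Subtype.val hz)
  · rintro ⟨z, hz⟩
    by_cases hzu : z = u
    · exact Or.inl (Subtype.ext hzu)
    · exact Or.inr ⟨⟨z, mem_coe.2 (mem_erase.2 ⟨hzu, mem_coe.1 hz⟩)⟩, rfl⟩
  · change (addStar G x {y}).Adj x y
    simp [addStar_adj, hxy]
  · rintro ⟨p, hp⟩ ⟨q, hq⟩
    change G.Adj p q ↔ (addStar G x {y}).Adj p q ∧ _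
    simp only [addStar_adj, ne_eq, Sym2.eq_iff, mem_singleton, Subtype.mk.injEq]
    constructor
    · intro hpq
      refine ⟨Or.inl hpq, ?_⟩
      rintro (⟨rfl, rfl⟩ | ⟨rfl, rfl⟩)
      · exact hnxy hpq
      · exact hnxy hpq.symm
    · rintro ⟨hpq | ⟨_, hpq⟩, hne⟩
      · exact hpq
      · tauto
  · rintro ⟨p, hp⟩
    change G.Adj u p ↔ _
    rw [hmem p (mem_of_mem_erase (mem_coe.1 hp))]
    simp

end

theorem IsTriangleForest.two_le_degIn (h : IsTriangleForest G A B k)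
    (h2 : ∀ v ∈ A, 2 ≤ degIn G v (A ∪ B)) : ∀ v ∈ A ∪ B, 2 ≤ degIn G v (A ∪ B) := by
  intro v hv
  rcases mem_union.1 hv with hv | hv
  · exact h2 v hv
  · rw [degIn_union h.disjoint, h.degIn_eq_two hv]
    omega

/-- Induction on the number of forest edges: each suppression removes exactly one, keeps `k` and
keeps all degrees at least two. -/
theorem isSubdivision_splitGraph (n : ℕ) : ∀ (G : SimpleGraph V) (A B : Finset V) (k : ℕ),
    IsTriangleForest G A B k → edgesIn G A = n → (∀ v ∈ A, 2 ≤ degIn G v (A ∪ B)) →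
    IsSubdivision (G.induce ((A ∪ B : Finset V) : Set V)) (splitGraph (k + 3) 3) := by
  induction n with
  | zero => exact fun G A B k h h0 _ => h.isSubdivision_of_edgesIn_eq_zero h0
  | succ n ih =>
    intro G A B k h hn h2
    obtain ⟨u, hu, x, hx, y, hy, hxy, hN⟩ := h.exists_degIn_eq_two (by omega) h2
    have hmem : ∀ z, z ∈ ({x, y} : Finset V) → G.Adj u z := by
      intro z hz
      rw [← hN] at hz
      exact (mem_filter.1 hz).2
    have hnxy := h.not_adj_of_filter_eq hu hx hy (hmem x (by simp)) (hmem y (by simp))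
    have h' := h.suppress hu hx hy hxy hN
    have huB : u ∉ B := fun hB => h.notMem hB hu
    have hS : (A ∪ B).erase u = A.erase u ∪ B := by
      rw [erase_union_distrib, erase_eq_of_notMem huB]
    refine IsSubdivision.of_suppress (mem_union_left _ hu) (mem_union_left _ hx) hy hxy hnxy hN ?_
    rw [hS]
    refine ih _ _ _ _ h' ?_ ?_
    · have h3 := h'.edgesIn_add
      have h4 := h.edgesIn_add
      have h5 := card_erase_add_one hu
      omega
    · intro v hv
      rw [← hS]
      exact two_le_degIn_suppress (fun w hw _ => h.two_le_degIn h2 w hw) (mem_union_left _ hu)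
        (mem_union_left _ hx) hy hxy hnxy hN (hS ▸ mem_union_left _ hv)

end

/-! ### Degrees in subdivisions; minimality and uniqueness of the split graph -/

section
open scoped Classical

section
variable {X W : Type*} {H : SimpleGraph X} {N : SimpleGraph W} {f : W → X}
  {P : ∀ a b : W, N.Adj a b → H.Walk (f a) (f b)}

/-- The degree of a branch vertex of a subdivision. -/
theorem ncard_neighborSet_branch (hf : Function.Injective f)
    (hpath : ∀ a b (h : N.Adj a b), (P a b h).IsPath)
    (hrev : ∀ a b (h : N.Adj a b), P b a h.symm = (P a b h).reverse)
    (hb : ∀ a b (h : N.Adj a b) (c : W), f c ∈ (P a b h).support → c = a ∨ c = b)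
    (hm : ∀ a b (h : N.Adj a b) c d (h' : N.Adj c d), s(a, b) ≠ s(c, d) →
      ∀ x, x ∈ (P a b h).support → x ∈ (P c d h').support → x ∈ Set.range f)
    (hE : ∀ e ∈ H.edgeSet, ∃ a b, ∃ h : N.Adj a b, e ∈ (P a b h).edges) (t : W) :
    (H.neighborSet (f t)).ncard = (N.neighborSet t).ncard := by
  -- The neighbours of `f t` are the second vertices of the paths starting there; the value `f t` at
  -- non-neighbours of `t` is never used.
  obtain ⟨g, hg⟩ : ∃ g : W → X, ∀ s (h : N.Adj t s), g s = (P t s h).snd :=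
    ⟨fun s => if h : N.Adj t s then (P t s h).snd else f t, fun s h => dif_pos h⟩
  have hadj : ∀ s, N.Adj t s → H.Adj (f t) (g s) := by
    intro s h
    rw [hg s h]
    exact Walk.adj_snd (Walk.not_nil_of_ne fun e => h.ne (hf e))
  have himg : H.neighborSet (f t) = g '' N.neighborSet t := by
    ext x
    constructor
    · intro hx
      have hx : H.Adj (f t) x := hx
      have key : ∀ b (h : N.Adj t b), s(f t, x) ∈ (P t b h).edges → x ∈ g '' N.neighborSet t := by
        intro b h he
        refine ⟨b, h, ?_⟩
        rw [hg b h]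
        exact (hpath t b h).snd_of_toSubgraph_adj ((P t b h).mem_edges_toSubgraph.2 he)
      obtain ⟨a, b, h, he⟩ := hE s(f t, x) hx
      rcases hb a b h t (Walk.fst_mem_support_of_mem_edges _ he) with rfl | rfl
      · exact key b h he
      · refine key a h.symm ?_
        rw [hrev, Walk.edges_reverse, List.mem_reverse]
        exact he
    · rintro ⟨s, hs, rfl⟩
      exact hadj s hs
  have hinj : Set.InjOn g (N.neighborSet t) := by
    intro s hs s' hs' hss
    have hs : N.Adj t s := hs
    have hs' : N.Adj t s' := hs'
    by_contra hne
    have hmem : ∀ r, (h : N.Adj t r) → g r ∈ (P t r h).support := fun r h => by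
      rw [hg r h]; exact Walk.getVert_mem_support _ _
    have hmem' := hmem s' hs'
    rw [← hss] at hmem'
    obtain ⟨c, hc⟩ := hm t s hs t s' hs' (by rw [ne_eq, Sym2.congr_right]; exact hne) _
      (hmem s hs) hmem'
    have hct : c ≠ t := fun e => (hadj s hs).ne (by rw [← hc, e])
    have h1 := hb t s hs c (hc ▸ hmem s hs)
    have h2 := hb t s' hs' c (hc ▸ hmem')
    have h3 := h1.resolve_left hct
    have h4 := h2.resolve_left hct
    exact hne (h3.symm.trans h4)
  rw [himg, hinj.ncard_image]

/-- The degree of an inner vertex of a path of a subdivision. -/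
theorem ncard_neighborSet_inner [Finite X]
    (hpath : ∀ a b (h : N.Adj a b), (P a b h).IsPath)
    (hrev : ∀ a b (h : N.Adj a b), P b a h.symm = (P a b h).reverse)
    (hm : ∀ a b (h : N.Adj a b) c d (h' : N.Adj c d), s(a, b) ≠ s(c, d) →
      ∀ x, x ∈ (P a b h).support → x ∈ (P c d h').support → x ∈ Set.range f)
    (hV : ∀ x : X, x ∈ Set.range f ∨ ∃ a b, ∃ h : N.Adj a b, x ∈ (P a b h).support)
    (hE : ∀ e ∈ H.edgeSet, ∃ a b, ∃ h : N.Adj a b, e ∈ (P a b h).edges) {z : X}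
    (hz : z ∉ Set.range f) : (H.neighborSet z).ncard ≤ 2 := by
  obtain ⟨a, b, h, hzs⟩ := (hV z).resolve_left hz
  have hsub : H.neighborSet z ⊆ (P a b h).toSubgraph.neighborSet z := by
    intro x hx
    obtain ⟨c, d, h', he⟩ := hE s(z, x) hx
    have heq : s(a, b) = s(c, d) := by
      by_contra hne
      exact hz (hm a b h c d h' hne z hzs (Walk.fst_mem_support_of_mem_edges _ he))
    refine Subgraph.mem_edgeSet.1 ((P a b h).mem_edges_toSubgraph.2 ?_)
    rcases Sym2.eq_iff.1 heq with ⟨rfl, rfl⟩ | ⟨rfl, rfl⟩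
    · exact he
    · rw [hrev, Walk.edges_reverse, List.mem_reverse] at he
      exact he
  refine (Set.ncard_le_ncard hsub (Set.toFinite _)).trans ?_
  obtain ⟨i, rfl, hi⟩ := Walk.mem_support_iff_exists_getVert.1 hzs
  refine ((hpath a b h).ncard_neighborSet_toSubgraph_internal_eq_two ?_ ?_).le
  · rintro rfl
    exact hz ⟨a, by simp⟩
  · refine lt_of_le_of_ne hi ?_
    rintro rfl
    exact hz ⟨b, by simp⟩

end

section
variable {X W W₀ : Type*} {H : SimpleGraph X} {N : SimpleGraph W} {N₀ : SimpleGraph W₀}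

theorem IsSubdivision.finite [Finite X] (h : IsSubdivision H N) : Finite W := by
  obtain ⟨f, _, hf, _⟩ := h
  exact Finite.of_injective f hf

/-- A vertex of degree at least three in `H` cannot be an inner vertex of a path, so each branch
vertex for `N₀` is also one for `N`. Both degrees equal the degree in `H`. -/
theorem IsSubdivision.exists_injective [Finite X] (h₀ : IsSubdivision H N₀) (h : IsSubdivision H N)
    (h3 : ∀ t, 3 ≤ (N₀.neighborSet t).ncard) :
    ∃ g : W₀ → W, Function.Injective g ∧
      ∀ t, (N.neighborSet (g t)).ncard = (N₀.neighborSet t).ncard := by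
  obtain ⟨f₀, P₀, hf₀, hpath₀, hrev₀, hb₀, hm₀, hV₀, hE₀⟩ := h₀
  obtain ⟨f, P, hf, hpath, hrev, hb, hm, hV, hE⟩ := h
  have hd₀ := ncard_neighborSet_branch hf₀ hpath₀ hrev₀ hb₀ hm₀ hE₀
  have hd := ncard_neighborSet_branch hf hpath hrev hb hm hE
  have hr : ∀ t, ∃ s, f s = f₀ t := by
    intro t
    by_contra hcon
    have := ncard_neighborSet_inner hpath hrev hm hV hE (z := f₀ t) hcon
    have := hd₀ t
    have := h3 t
    omega
  choose g hg using hr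
  refine ⟨g, fun s t hst => hf₀ ?_, fun t => ?_⟩
  · rw [← hg s, ← hg t, hst]
  · rw [← hd, hg, hd₀]

theorem IsSubdivision.exists_le_ncard_neighborSet (h : IsSubdivision H N) {d : ℕ}
    (hd : ∀ x, d ≤ (H.neighborSet x).ncard) (t : W) : d ≤ (N.neighborSet t).ncard := by
  obtain ⟨f, P, hf, hpath, hrev, hb, hm, hV, hE⟩ := h
  rw [← ncard_neighborSet_branch hf hpath hrev hb hm hE]
  exact hd _

theorem sum_ncard_neighborSet [Fintype W] (N : SimpleGraph W) :
    ∑ t, (N.neighborSet t).ncard = 2 * N.edgeSet.ncard := by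
  rw [← edgesIn_univ, ← sum_degIn]
  refine sum_congr rfl fun t _ => ?_
  rw [← ncard_neighborSet_inter]
  simp

theorem IsSubdivision.ncard_edgeSet_le [Finite X] (h₀ : IsSubdivision H N₀) (h : IsSubdivision H N)
    (h3 : ∀ t, 3 ≤ (N₀.neighborSet t).ncard) : N₀.edgeSet.ncard ≤ N.edgeSet.ncard := by
  have := h.finite
  have := h₀.finite
  cases nonempty_fintype W
  cases nonempty_fintype W₀
  obtain ⟨g, hg, hdeg⟩ := h₀.exists_injective h h3
  have h1 := sum_ncard_neighborSet N
  have h2 := sum_ncard_neighborSet N₀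
  rw [← sum_congr rfl fun t _ => hdeg t,
    ← sum_image (f := fun t => (N.neighborSet t).ncard) hg.injOn] at h2
  have := sum_le_sum_of_subset (f := fun t => (N.neighborSet t).ncard)
    (subset_univ (univ.image g))
  omega

theorem IsSubdivision.exists_bijective [Finite X] (h₀ : IsSubdivision H N₀) (h : IsSubdivision H N)
    (h3 : ∀ t, 3 ≤ (N₀.neighborSet t).ncard) (hH : ∀ x, 1 ≤ (H.neighborSet x).ncard)
    (hle : N.edgeSet.ncard ≤ N₀.edgeSet.ncard) :
    ∃ g : W₀ → W, Function.Bijective g ∧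
      ∀ t, (N.neighborSet (g t)).ncard = (N₀.neighborSet t).ncard := by
  have := h.finite
  have := h₀.finite
  cases nonempty_fintype W
  cases nonempty_fintype W₀
  obtain ⟨g, hg, hdeg⟩ := h₀.exists_injective h h3
  refine ⟨g, ⟨hg, ?_⟩, hdeg⟩
  -- A further vertex of `N` has positive degree and would push the degree sum above that of `N₀`.
  by_contra hsurj
  rw [Function.Surjective] at hsurj
  push Not at hsurj
  obtain ⟨s, hs⟩ := hsurj
  have h1 := sum_ncard_neighborSet N
  have h2 := sum_ncard_neighborSet N₀
  rw [← sum_congr rfl fun t _ => hdeg t,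
    ← sum_image (f := fun t => (N.neighborSet t).ncard) hg.injOn] at h2
  have hs' : s ∉ univ.image g := by simpa using hs
  have h4 := sum_le_sum_of_subset (f := fun t => (N.neighborSet t).ncard)
    (subset_univ (insert s (univ.image g)))
  rw [sum_insert hs'] at h4
  have := h.exists_le_ncard_neighborSet hH s
  omega

end

theorem splitGraph_adj {n t : ℕ} {i j : Fin n} :
    (splitGraph n t).Adj i j ↔ i ≠ j ∧ ((i : ℕ) < t ∨ (j : ℕ) < t) := Iff.rfl

theorem three_le_ncard_neighborSet_splitGraph {k : ℕ} (hk : 1 ≤ k) (i : Fin (k + 3)) :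
    3 ≤ ((splitGraph (k + 3) 3).neighborSet i).ncard := by
  have hinj : Function.Injective fun j : Fin 3 => (⟨j, by omega⟩ : Fin (k + 3)) := by
    intro j j' h
    simpa [Fin.ext_iff] using h
  by_cases hi : (i : ℕ) < 3
  · have : (splitGraph (k + 3) 3).neighborSet i = {i}ᶜ := by
      ext j
      simp only [mem_neighborSet, splitGraph_adj, Set.mem_compl_iff, Set.mem_singleton_iff]
      tauto
    rw [this, Set.ncard_compl, Set.ncard_singleton, Nat.card_eq_fintype_card, Fintype.card_fin]
    omega
  · have hsub : (Set.range fun j : Fin 3 => (⟨j, by omega⟩ : Fin (k + 3))) ⊆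
        (splitGraph (k + 3) 3).neighborSet i := by
      rintro _ ⟨j, rfl⟩
      rw [mem_neighborSet, splitGraph_adj]
      have := j.2
      refine ⟨fun e => hi ?_, Or.inr this⟩
      rw [e]
      exact this
    have h1 := Set.ncard_le_ncard hsub (Set.toFinite _)
    rwa [← Set.image_univ, Set.ncard_image_of_injective _ hinj, Set.ncard_univ,
      Nat.card_eq_fintype_card, Fintype.card_fin] at h1

/-- Split graphs are determined by their degrees. -/
theorem nonempty_iso_splitGraph {n t : ℕ} {W : Type*} {M : SimpleGraph W} {g : Fin n → W}
    (hg : Function.Bijective g)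
    (hdeg : ∀ i, (M.neighborSet (g i)).ncard = ((splitGraph n t).neighborSet i).ncard) :
    Nonempty (M ≃g splitGraph n t) := by
  have hdeg' : ∀ i, ((M.comap g).neighborSet i).ncard =
      ((splitGraph n t).neighborSet i).ncard := by
    intro i
    rw [← hdeg i, ← Set.ncard_image_of_injective _ hg.1]
    congr 1
    ext x
    obtain ⟨j, rfl⟩ := hg.2 x
    simp [hg.1.eq_iff]
  -- Degree `n - 1` forces adjacency to everything. This already yields all edges of the split
  -- graph, and equal degrees leave no room for more.
  have htop : ∀ i : Fin n, (i : ℕ) < t → ∀ j, i ≠ j → M.Adj (g i) (g j) := by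
    intro i hi j hij
    have h1 : (splitGraph n t).neighborSet i = {i}ᶜ := by
      ext j
      simp only [mem_neighborSet, splitGraph_adj, Set.mem_compl_iff, Set.mem_singleton_iff]
      tauto
    have h2 : (M.comap g).neighborSet i ⊆ {i}ᶜ := by
      intro j hj
      exact fun e => Adj.ne hj (congrArg g e.symm)
    have h3 := Set.eq_of_subset_of_ncard_le h2 (by rw [hdeg', h1]) (Set.toFinite _)
    have h4 : j ∈ (M.comap g).neighborSet i := by rw [h3]; exact fun e => hij e.symm
    exact h4
  have hsub : ∀ i, (splitGraph n t).neighborSet i ⊆ (M.comap g).neighborSet i := by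
    rintro i j ⟨hij, hi | hj⟩
    · exact htop i hi j hij
    · exact (htop j hj i hij.symm).symm
  have hiff : ∀ i j, M.Adj (g i) (g j) ↔ (splitGraph n t).Adj i j := by
    intro i j
    have := Set.eq_of_subset_of_ncard_le (hsub i) (hdeg' i).le (Set.toFinite _)
    have h2 : j ∈ (splitGraph n t).neighborSet i ↔ j ∈ (M.comap g).neighborSet i := by rw [this]
    exact h2.symm
  exact ⟨RelIso.symm ⟨Equiv.ofBijective g hg, fun {i j} => hiff i j⟩⟩

theorem ncard_neighborSet_induce {V : Type*} (G : SimpleGraph V) (S : Set V) (v : S) :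
    ((G.induce S).neighborSet v).ncard = (G.neighborSet v ∩ S).ncard := by
  rw [← Set.ncard_image_of_injective _ Subtype.val_injective]
  congr 1
  ext x
  simp

end
end DisjointCycles

/-! ### Assembly of the main theorem -/

open DisjointCycles in
theorem mainTheorem3 {V : Type*} [Finite V] (G : SimpleGraph V)
    (hsat : DisjointCycles.IsSaturated DisjointCycles.twoCycles G)
    (hn : 7 ≤ Nat.card V)
    (hm : 2 * Nat.card V - 1 ≤ G.edgeSet.ncard) :
    (∃ n₀ : ℕ,
      ((7 ≤ n₀ ∧ n₀ ≤ Nat.card V) ∨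
        (Nat.card V = 7 ∧ G.edgeSet.ncard = 13 ∧ n₀ = 6)) ∧
      DisjointCycles.IsReducedCore G (DisjointCycles.splitGraph n₀ 3) ∧
      ∀ {W : Type*} (M : SimpleGraph W), DisjointCycles.IsReducedCore G M →
        Nonempty (M ≃g DisjointCycles.splitGraph n₀ 3)) ∧
    Even ((G.edgeSet.ncard : ℤ) - (Nat.card V : ℤ)) := by
  classical
  cases nonempty_fintype V
  have hcard : Finset.card (Finset.univ : Finset V) = Nat.card V := by simp
  have hedge := edgesIn_univ G
  obtain ⟨a, b, c, hhit⟩ : ∃ a b c, IsTripleHit G Finset.univ a b c := by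
    rcases exists_isTripleHit_or _ G Finset.univ le_rfl (Finset.card_pos.1 (by omega))
      (noTwoCycles_univ_iff.2 hsat.1) (by omega) with h | h
    · exact h
    · omega
  obtain ⟨k, hk⟩ := isTriangleForest_of_isSaturated hsat hhit
  obtain ⟨A, hA⟩ : ∃ A : Finset V, A = Finset.univ \ {a, b, c} := ⟨_, rfl⟩
  obtain ⟨B, hB⟩ : ∃ B : Finset V, B = {a, b, c} := ⟨_, rfl⟩
  rw [← hA, ← hB] at hk
  have huniv : A ∪ B = Finset.univ := by
    rw [hA, hB, Finset.sdiff_union_of_subset (Finset.subset_univ _)]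
  have hcardV : Finset.card A + 3 = Nat.card V := by
    rw [← hcard, ← huniv, Finset.card_union_of_disjoint hk.disjoint, hk.card_triangle]
  have hedgeV := hk.edgesIn_union
  rw [huniv, hedge] at hedgeV
  have hadd := hk.edgesIn_add
  have hcore : ∀ S, IsLeaflessCore G S → IsSubdivision (G.induce S) (splitGraph (k + 3) 3) ∧
      ∀ x, 1 ≤ ((G.induce S).neighborSet x).ncard := by
    rintro S ⟨hS, hleaf⟩
    obtain ⟨A', rfl, hA'⟩ := hk.leafDeletion huniv hS
    have hdeg : ∀ v ∈ A', 2 ≤ degIn G v (A' ∪ B) := by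
      intro v hv
      have h1 := hleaf v (by simp [hv])
      rw [ncard_neighborSet_inter] at h1
      by_contra h2
      have h0 : degIn G v (A' ∪ B) = 0 := by omega
      rw [degIn_union hA'.disjoint] at h0
      have h3 : degIn G v B = Finset.card B :=
        degIn_eq_card.2 fun t ht => (hA'.adj_of_degIn_eq_zero hv (by omega) ht).symm
      have := hA'.card_triangle
      omega
    refine ⟨isSubdivision_splitGraph _ G A' B k hA' rfl hdeg, ?_⟩
    rintro ⟨x, hx⟩
    rw [ncard_neighborSet_induce, ncard_neighborSet_inter]
    exact (hA'.two_le_degIn hdeg x (Finset.mem_coe.1 hx)).trans' one_le_two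
  have h3 := three_le_ncard_neighborSet_splitGraph (k := k) (by omega)
  -- The counts give `m = n + 2k`. So `m ≥ 2n - 1` means `2k ≥ n - 1 ≥ 6`; the value `k = 3` forces
  -- `n = 7` and `m = 13`, and otherwise `k + 3 ≥ 7`. The upper bound is `k ≤ #A = n - 3`.
  refine ⟨⟨k + 3, by omega, ?_, ?_⟩, ⟨k, by push_cast [hedgeV, ← hcardV, ← hadd]; ring⟩⟩
  · obtain ⟨S, hS⟩ := exists_isLeaflessCore G
    exact ⟨S, hS, (hcore S hS).1, fun n N hN => (hcore S hS).1.ncard_edgeSet_le hN h3⟩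
  · rintro W M ⟨S, hS, hM, hmin⟩
    obtain ⟨hsub, hpos⟩ := hcore S hS
    obtain ⟨g, hg, hdeg⟩ := hsub.exists_bijective hM h3 hpos (hmin _ _ hsub)
    exact nonempty_iso_splitGraph hg hdeg
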